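/- Let $N\ge 0$ be an integer, let $V_N$ be a random matrix distributed according to the Haar probability measure on the unitary group $U(N)$, let $e^{i\theta_1},\dots,e^{i\theta_N}$ be its eigenvalues (with multiplicity), fix $\theta\in\mathbb R$, and put $$Z_N=\det\bigl(I_N-e^{-i\theta}V_N\bigr)=\prod_{n=1}^N\bigl(1-e^{i(\theta_n-\theta)}\bigr).$$ Then $Z_N\neq 0$ almost surely, so that $\arg Z_N$ is almost surely well defined as the imaginary part of $$\log Z_N:=\sum_{n=1}^N\log\bigl(1-e^{i(\theta_n-\theta)}\bigr),\qquad \operatorname{Im}\log\bigl(1-e^{i(\theta_n-\theta)}\bigr)\in(-\pi/2,\pi/2].$$ For all $t,s\in\mathbb C$ with $\operatorname{Re}(t+s)>-1$ and $\operatorname{Re}(t-s)>-1$, the random variable $|Z_N|^t e^{is\arg Z_N}$ is integrable and $$\mathbb E\bigl(|Z_N|^t e^{is\arg Z_N}\bigr)=\prod_{k=1}^N\frac{\Gamma(k)\,\Gamma(k+t)}{\Gamma\bigl(k+\frac{t+s}{2}\bigr)\,\Gamma\bigl(k+\frac{t-s}{2}\bigr)}.$$ -/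

import Mathlib

open MeasureTheory

/-- The unitary group `U(N)` carries its Borel σ-algebra. -/
noncomputable instance unitaryGroupMeasurableSpace (N : ℕ) : MeasurableSpace (Matrix.unitaryGroup (Fin N) ℂ) :=
  borel _

instance unitaryGroupBorelSpace (N : ℕ) : BorelSpace (Matrix.unitaryGroup (Fin N) ℂ) := ⟨rfl⟩

/-- The characteristic polynomial `Z(V, θ) = det (I - e^{-iθ} V)` of a unitary matrix `V`,
evaluated on the unit circle. -/
noncomputable def charPolyCircle {N : ℕ} (V : Matrix.unitaryGroup (Fin N) ℂ) (θ : ℝ) : ℂ :=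
  Matrix.det (1 - Complex.exp (-(Complex.I * θ)) • (V : Matrix (Fin N) (Fin N) ℂ))

/-- `log Z(V, θ) = ∑ₙ log (1 - e^{-iθ} λₙ)`, the sum running over the eigenvalues `λₙ` of `V`
with multiplicity. As `1 - e^{-iθ} λₙ` has nonnegative real part, the principal branch has
imaginary part in `[-π/2, π/2]`. A genuine logarithm exactly when `Z(V, θ) ≠ 0`. -/
noncomputable def logCharPolyCircle {N : ℕ} (V : Matrix.unitaryGroup (Fin N) ℂ) (θ : ℝ) : ℂ :=
  ((V : Matrix (Fin N) (Fin N) ℂ).charpoly.roots.map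
    (fun z => Complex.log (1 - Complex.exp (-(Complex.I * θ)) * z))).sum

/-- `arg Z(V, θ)`: the imaginary part of `log Z(V, θ)` (not reduced modulo `2π`). -/
noncomputable def argCharPolyCircle {N : ℕ} (V : Matrix.unitaryGroup (Fin N) ℂ) (θ : ℝ) : ℝ :=
  (logCharPolyCircle V θ).im

/-! ### Compactness of the unitary group, Haar measure and null sets -/

section UnitaryGroup

variable {N : ℕ}

/-! Haar invariance absorbs the phase `e^{-iθ}` into `V`. With `w = log Z`, `a = (t+s)/2` and `b =
(t-s)/2`, the variable to integrate is `exp (a w + b w̄)`, which turns sums of logarithms into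
products. The right-hand side then comes from a factorization in law: `Z` for `U(n+1)` is `1 - V₀₀`
times an independent copy of `Z` for `U(n)`.

The factorization is a Schur complement: `det (1 - V) = (1 - V₀₀) det (1 - T V)`, where `T V` is
again unitary (`schurTransfer_mem_unitaryGroup`). Left multiplication by `1 ⊕ U` fixes the first row
of `V` and replaces `T V` by `U (T V)`; averaging over a Haar distributed `U` makes the second
factor Haar and independent of `V` (`integral_expPair_logDetOneSub_succ`). As the argument is not
reduced modulo `2π`, the identity is needed for the logarithms themselves; this follows by deforming
`V` to `0` and uniqueness of continuous lifts through `exp`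
(`logDetOneSub_eq_log_add_logDetOneSub_schurTransfer`).

For the single factor in `U(n)`, `(1 - V₀₀)^a` and its conjugate analogue are expanded in binomial
series. Phase invariance kills the off-diagonal terms, and the moments of `|V₀₀|²`
(`integral_entry_pow_mul_conj_pow`) turn the rest into `₂F₁(-a, -b; n; 1)`, evaluated by Gauss's
theorem (`tsum_gaussTerm`). Since `|V₀₀|` may come arbitrarily close to `1`, the computation is made
for `r V₀₀` with `r < 1`, and then `r → 1`. -/

theorem unitaryGroup_sum_normSq_row (V : Matrix.unitaryGroup (Fin N) ℂ) (i : Fin N) :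
    ∑ j, ‖(V : Matrix (Fin N) (Fin N) ℂ) i j‖ ^ 2 = 1 := by
  have h : (V : Matrix (Fin N) (Fin N) ℂ) * star (V : Matrix (Fin N) (Fin N) ℂ) = 1 :=
    Matrix.mem_unitaryGroup_iff.1 V.2
  have h1 := congrFun (congrFun h i) i
  rw [Matrix.mul_apply, Matrix.one_apply_eq] at h1
  have h2 : ((∑ j, ‖(V : Matrix (Fin N) (Fin N) ℂ) i j‖ ^ 2 : ℝ) : ℂ) = 1 := by
    rw [← h1]
    push_cast
    refine Finset.sum_congr rfl fun j _ => ?_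
    rw [Matrix.star_apply, ← Complex.mul_conj']
    rfl
  exact_mod_cast h2

theorem unitaryGroup_sum_normSq_col (V : Matrix.unitaryGroup (Fin N) ℂ) (j : Fin N) :
    ∑ i, ‖(V : Matrix (Fin N) (Fin N) ℂ) i j‖ ^ 2 = 1 := by
  have := unitaryGroup_sum_normSq_row (star V) j
  rw [← this]
  refine Finset.sum_congr rfl fun i _ => ?_
  simp [Matrix.star_apply]

theorem unitaryGroup_norm_entry_le_one (V : Matrix.unitaryGroup (Fin N) ℂ) (i j : Fin N) :
    ‖(V : Matrix (Fin N) (Fin N) ℂ) i j‖ ≤ 1 := by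
  have h := unitaryGroup_sum_normSq_row V i
  have h1 := Finset.single_le_sum (f := fun j => ‖(V : Matrix (Fin N) (Fin N) ℂ) i j‖ ^ 2)
    (fun j _ => by positivity) (Finset.mem_univ j)
  have h2 : ‖(V : Matrix (Fin N) (Fin N) ℂ) i j‖ ^ 2 ≤ 1 := h ▸ h1
  nlinarith [norm_nonneg ((V : Matrix (Fin N) (Fin N) ℂ) i j)]

theorem isClosed_unitaryGroup :
    IsClosed (Matrix.unitaryGroup (Fin N) ℂ : Set (Matrix (Fin N) (Fin N) ℂ)) := by
  have : (Matrix.unitaryGroup (Fin N) ℂ : Set (Matrix (Fin N) (Fin N) ℂ))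
      = {A | A * star A = 1} := by
    ext A; exact Matrix.mem_unitaryGroup_iff
  rw [this]
  exact isClosed_eq (by fun_prop) continuous_const

instance unitaryGroupCompactSpace : CompactSpace (Matrix.unitaryGroup (Fin N) ℂ) := by
  refine isCompact_iff_compactSpace.1 ?_
  have hc : IsCompact (Set.univ.pi fun _ : Fin N => Set.univ.pi fun _ : Fin N =>
      Metric.closedBall (0 : ℂ) 1) :=
    isCompact_univ_pi fun _ => isCompact_univ_pi fun _ => isCompact_closedBall _ _
  refine hc.of_isClosed_subset isClosed_unitaryGroup fun A hA i _ j _ => ?_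
  rw [mem_closedBall_zero_iff]
  exact unitaryGroup_norm_entry_le_one ⟨A, hA⟩ i j

instance unitaryGroupSecondCountable :
    SecondCountableTopology (Matrix.unitaryGroup (Fin N) ℂ) := by
  have : SecondCountableTopology (Matrix (Fin N) (Fin N) ℂ) :=
    inferInstanceAs (SecondCountableTopology (Fin N → Fin N → ℂ))
  exact TopologicalSpace.Subtype.secondCountableTopology _

instance unitaryGroupIsTopologicalGroup :
    IsTopologicalGroup (Matrix.unitaryGroup (Fin N) ℂ) :=
  inferInstanceAs (IsTopologicalGroup (unitary (Matrix (Fin N) (Fin N) ℂ)))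

theorem continuous_unitaryGroup_coe :
    Continuous (fun V : Matrix.unitaryGroup (Fin N) ℂ => (V : Matrix (Fin N) (Fin N) ℂ)) :=
  continuous_subtype_val

theorem continuous_unitaryGroup_entry (i j : Fin N) :
    Continuous (fun V : Matrix.unitaryGroup (Fin N) ℂ => (V : Matrix (Fin N) (Fin N) ℂ) i j) :=
  continuous_subtype_val.matrix_elem i j

/-- A compact group is unimodular: the right translate of `μ` is still left invariant, hence a
multiple of `μ`, and total mass forces the multiple to be `1`. -/
theorem measurePreserving_mul_right_of_compactSpace {G : Type*} [Group G] [TopologicalSpace G]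
    [IsTopologicalGroup G] [CompactSpace G] [MeasurableSpace G] [BorelSpace G]
    [SecondCountableTopology G]
    (μ : Measure G) [μ.IsHaarMeasure] [IsProbabilityMeasure μ] (g : G) :
    MeasurePreserving (· * g) μ μ := by
  have hm : Measurable (· * g : G → G) := (continuous_mul_const g).measurable
  refine ⟨hm, ?_⟩
  have : IsProbabilityMeasure (μ.map (· * g)) := Measure.isProbabilityMeasure_map hm.aemeasurable
  have h := Measure.isMulInvariant_eq_smul_of_compactSpace (μ.map (· * g)) μ
  have h1 := congrArg (fun ν => ν Set.univ) h
  simp only [measure_univ, Measure.smul_apply] at h1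
  rw [h]
  have h2 : Measure.haarScalarFactor (μ.map (· * g)) μ = 1 := by
    rw [ENNReal.smul_def, smul_eq_mul, mul_one] at h1
    exact_mod_cast h1.symm
  rw [h2, one_smul]

theorem exists_haar_probability_measure (N : ℕ) :
    ∃ μ : Measure (Matrix.unitaryGroup (Fin N) ℂ), μ.IsHaarMeasure ∧ IsProbabilityMeasure μ := by
  let K : TopologicalSpace.PositiveCompacts (Matrix.unitaryGroup (Fin N) ℂ) := ⊤
  refine ⟨Measure.haarMeasure K, inferInstance, ⟨?_⟩⟩
  exact Measure.haarMeasure_self (K₀ := K)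

/-- Multiplication by a unimodular scalar, as an element of the unitary group. -/
noncomputable def unitaryScalar (N : ℕ) (c : Circle) : Matrix.unitaryGroup (Fin N) ℂ :=
  ⟨(c : ℂ) • (1 : Matrix (Fin N) (Fin N) ℂ), by
    rw [Matrix.mem_unitaryGroup_iff]
    simp [smul_smul, ← Complex.normSq_eq_conj_mul_self]⟩

theorem unitaryScalar_mul_coe (c : Circle) (V : Matrix.unitaryGroup (Fin N) ℂ) :
    ((unitaryScalar N c * V : Matrix.unitaryGroup (Fin N) ℂ) : Matrix (Fin N) (Fin N) ℂ)
      = (c : ℂ) • (V : Matrix (Fin N) (Fin N) ℂ) := by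
  simp [unitaryScalar]

theorem continuous_unitaryScalar : Continuous (unitaryScalar N) := by
  refine Continuous.subtype_mk ?_ _
  fun_prop

theorem countable_circleExp_preimage {s : Set ℂ} (hs : s.Finite) :
    {x : ℝ | (Circle.exp x : ℂ) ∈ s}.Countable := by
  have h1 : {x : ℝ | (Circle.exp x : ℂ) ∈ s} = ⋃ z ∈ s, {x : ℝ | (Circle.exp x : ℂ) = z} := by
    ext x; simp
  rw [h1]
  refine hs.countable.biUnion fun z _ => ?_
  rcases Set.eq_empty_or_nonempty {x : ℝ | (Circle.exp x : ℂ) = z} with h | ⟨y, hy⟩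
  · rw [h]; exact Set.countable_empty
  · refine (Set.countable_range fun n : ℤ => y + n * (2 * Real.pi)).mono fun x hx => ?_
    have hxy : Circle.exp x = Circle.exp y := Circle.ext (hx.trans hy.symm)
    rw [Circle.exp_eq_exp] at hxy
    obtain ⟨m, hm⟩ := hxy
    exact ⟨m, hm.symm⟩

/-- Fubini: the exceptional pairs `(V, x)` form a null set, so for some angle `x` the rotated matrix
satisfies `p` almost surely; invariance of `μ` then removes the rotation. -/
theorem ae_of_countable_rotations (μ : Measure (Matrix.unitaryGroup (Fin N) ℂ))
    [μ.IsHaarMeasure] [IsProbabilityMeasure μ] {p : Matrix.unitaryGroup (Fin N) ℂ → Prop}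
    (hp : MeasurableSet {V | p V})
    (h : ∀ V, {x : ℝ | ¬ p (unitaryScalar N (Circle.exp x) * V)}.Countable) :
    ∀ᵐ V ∂μ, p V := by
  have h1 : ∀ᵐ V ∂μ, ∀ᵐ x : ℝ, p (unitaryScalar N (Circle.exp x) * V) :=
    Filter.Eventually.of_forall fun V => (h V).measure_zero volume
  have hm : Measurable fun q : Matrix.unitaryGroup (Fin N) ℂ × ℝ =>
      unitaryScalar N (Circle.exp q.2) * q.1 := by
    have := continuous_unitaryScalar (N := N)
    exact Continuous.measurable (by fun_prop)
  rw [Measure.ae_ae_comm (p := fun V (x : ℝ) => p (unitaryScalar N (Circle.exp x) * V))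
    (hm hp)] at h1
  obtain ⟨x, hx⟩ := h1.exists
  exact (eventually_mul_left_iff μ _).1 hx

theorem eval_charpolyRev_eq_det {n : ℕ} (A : Matrix (Fin n) (Fin n) ℂ) (c : ℂ) :
    A.charpolyRev.eval c = (1 - c • A).det := by
  rw [Matrix.charpolyRev, ← Polynomial.coe_evalRingHom, RingHom.map_det]
  congr 1
  ext i j
  simp [Matrix.one_apply, apply_ite (Polynomial.eval c)]
  ring

theorem measurable_det_ne_zero :
    MeasurableSet {V : Matrix.unitaryGroup (Fin N) ℂ |
      (1 - (V : Matrix (Fin N) (Fin N) ℂ)).det ≠ 0} := by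
  have h : Continuous fun V : Matrix.unitaryGroup (Fin N) ℂ =>
      (1 - (V : Matrix (Fin N) (Fin N) ℂ)).det := by
    have := continuous_unitaryGroup_coe (N := N)
    fun_prop
  exact (isOpen_ne_fun h continuous_const).measurableSet

theorem ae_det_one_sub_ne_zero (μ : Measure (Matrix.unitaryGroup (Fin N) ℂ))
    [μ.IsHaarMeasure] [IsProbabilityMeasure μ] :
    ∀ᵐ V : Matrix.unitaryGroup (Fin N) ℂ ∂μ, (1 - (V : Matrix (Fin N) (Fin N) ℂ)).det ≠ 0 := by
  refine ae_of_countable_rotations μ measurable_det_ne_zero fun V => ?_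
  have h0 : (V : Matrix (Fin N) (Fin N) ℂ).charpolyRev ≠ 0 := by
    intro h
    have := Matrix.eval_charpolyRev (M := (V : Matrix (Fin N) (Fin N) ℂ))
    rw [h] at this
    simp at this
  refine (countable_circleExp_preimage
    (Polynomial.finite_setOfPred_isRoot h0)).mono fun x hx => ?_
  simp only [Set.mem_ofPred_eq, not_not, unitaryScalar_mul_coe] at hx
  simpa [Polynomial.IsRoot, eval_charpolyRev_eq_det] using hx

theorem measurable_entry_ne_one (i j : Fin N) :
    MeasurableSet {V : Matrix.unitaryGroup (Fin N) ℂ |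
      (V : Matrix (Fin N) (Fin N) ℂ) i j ≠ 1} :=
  (isOpen_ne_fun (continuous_unitaryGroup_entry i j) continuous_const).measurableSet

theorem ae_entry_ne_one (μ : Measure (Matrix.unitaryGroup (Fin N) ℂ))
    [μ.IsHaarMeasure] [IsProbabilityMeasure μ] (i j : Fin N) :
    ∀ᵐ V : Matrix.unitaryGroup (Fin N) ℂ ∂μ, (V : Matrix (Fin N) (Fin N) ℂ) i j ≠ 1 := by
  refine ae_of_countable_rotations μ (measurable_entry_ne_one i j) fun V => ?_
  refine (countable_circleExp_preimage
    (Set.finite_singleton ((V : Matrix (Fin N) (Fin N) ℂ) i j)⁻¹)).mono fun x hx => ?_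
  simp only [Set.mem_ofPred_eq, not_not, unitaryScalar_mul_coe, Matrix.smul_apply,
    smul_eq_mul] at hx
  exact eq_inv_of_mul_eq_one_left hx

end UnitaryGroup

/-! ### The logarithm of `det (1 - A)` and its continuity -/

section LogDet

/-- `∑ log (1 - λ)` over the eigenvalues `λ` of `A`, with multiplicity. -/
noncomputable def logDetOneSub {n : ℕ} (A : Matrix (Fin n) (Fin n) ℂ) : ℂ :=
  (A.charpoly.roots.map fun z => Complex.log (1 - z)).sum

theorem det_one_sub_smul_eq_prod_roots {n : ℕ} (A : Matrix (Fin n) (Fin n) ℂ) (c : ℂ) :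
    (1 - c • A).det = (A.charpoly.roots.map fun z => 1 - c * z).prod := by
  have hs : A.charpoly.Splits := IsAlgClosed.splits _
  have hcard : A.charpoly.roots.card = n := by
    rw [← hs.natDegree_eq_card_roots, Matrix.charpoly_natDegree_eq_dim, Fintype.card_fin]
  rcases eq_or_ne c 0 with rfl | hc
  · simp
  have h1 : (1 - c • A) = c • (c⁻¹ • (1 : Matrix (Fin n) (Fin n) ℂ) - A) := by
    rw [smul_sub, smul_smul, mul_inv_cancel₀ hc, one_smul]
  have h2 : (c⁻¹ • (1 : Matrix (Fin n) (Fin n) ℂ) - A).det = A.charpoly.eval c⁻¹ := by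
    rw [Matrix.eval_charpoly]
    congr 1
    ext i j
    simp [Matrix.one_apply, Matrix.scalar_apply, Matrix.diagonal_apply]
  have h3 : A.charpoly.eval c⁻¹ = (A.charpoly.roots.map fun z => c⁻¹ - z).prod := by
    conv_lhs => rw [hs.eq_prod_roots_of_monic A.charpoly_monic]
    rw [Polynomial.eval_multiset_prod, Multiset.map_map]
    simp
  have h4 : c ^ n = c ^ A.charpoly.roots.card := by rw [hcard]
  rw [h1, Matrix.det_smul, h2, h3, Fintype.card_fin, h4]
  rw [← Multiset.prod_replicate, ← Multiset.map_const', ← Multiset.prod_map_mul]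
  congr 1
  refine Multiset.map_congr rfl fun z _ => ?_
  rw [mul_sub, mul_inv_cancel₀ hc]

/-- Were `1 - σz` real and nonpositive, `z` would be real with `z ≥ 1`, and the determinant would
vanish at the parameter `z⁻¹ ∈ [0, 1]`. -/
theorem one_sub_smul_root_mem_slitPlane {n : ℕ} {A : Matrix (Fin n) (Fin n) ℂ}
    (hA : ∀ σ ∈ Set.Icc (0 : ℝ) 1, (1 - (σ : ℂ) • A).det ≠ 0) {z : ℂ} (hz : z ∈ A.charpoly.roots)
    {σ : ℝ} (hσ : σ ∈ Set.Icc (0 : ℝ) 1) : 1 - (σ : ℂ) * z ∈ Complex.slitPlane := by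
  have hne : ∀ σ ∈ Set.Icc (0 : ℝ) 1, 1 - (σ : ℂ) * z ≠ 0 := by
    intro σ hσ h0
    refine hA σ hσ ?_
    rw [det_one_sub_smul_eq_prod_roots]
    exact Multiset.prod_eq_zero (Multiset.mem_map.2 ⟨z, hz, h0⟩)
  by_contra hcon
  rw [Complex.mem_slitPlane_iff, not_or, not_lt, not_not] at hcon
  obtain ⟨hre, him⟩ := hcon
  simp only [Complex.sub_re, Complex.one_re, Complex.re_ofReal_mul, Complex.sub_im,
    Complex.one_im, Complex.im_ofReal_mul] at hre him
  have hσ0 : σ ≠ 0 := by rintro rfl; norm_num at hre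
  have hzim : z.im = 0 := by
    have : σ * z.im = 0 := by linarith
    exact (mul_eq_zero.1 this).resolve_left hσ0
  have hσp : 0 < σ := lt_of_le_of_ne hσ.1 (Ne.symm hσ0)
  have hz1 : 1 ≤ z.re := by
    by_contra hlt
    push Not at hlt
    nlinarith [hσ.2, mul_lt_mul_of_pos_left hlt hσp]
  have hzz : z = (z.re : ℂ) := Complex.ext rfl (by simp [hzim])
  refine hne (z.re)⁻¹ ⟨by positivity, inv_le_one_of_one_le₀ hz1⟩ ?_
  rw [hzz, Complex.ofReal_re, ← Complex.ofReal_mul, inv_mul_cancel₀ (by positivity)]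
  simp

theorem hasDerivAt_multiset_sum_log (m : Multiset ℂ) (σ : ℝ)
    (h : ∀ z ∈ m, 1 - (σ : ℂ) * z ∈ Complex.slitPlane) :
    HasDerivAt (fun x : ℝ => (m.map fun z => Complex.log (1 - (x : ℂ) * z)).sum)
      ((m.map fun z => -z / (1 - (σ : ℂ) * z)).sum) σ := by
  induction m using Multiset.induction with
  | empty => simpa using hasDerivAt_const σ (0 : ℂ)
  | cons a m ih =>
    simp only [Multiset.map_cons, Multiset.sum_cons]
    refine HasDerivAt.add ?_ (ih fun z hz => h z (Multiset.mem_cons_of_mem hz))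
    have h1 : HasDerivAt (fun x : ℝ => 1 - (x : ℂ) * a) (-a) σ := by
      simpa using ((Complex.ofRealCLM.hasDerivAt (x := σ)).mul_const a).const_sub 1
    exact h1.clog_real (h a (Multiset.mem_cons_self a m))

theorem exp_multiset_sum_log (m : Multiset ℂ) (c : ℂ) (h : ∀ z ∈ m, 1 - c * z ≠ 0) :
    Complex.exp ((m.map fun z => Complex.log (1 - c * z)).sum)
      = (m.map fun z => 1 - c * z).prod := by
  induction m using Multiset.induction with
  | empty => simp
  | cons a m ih =>
    simp only [Multiset.map_cons, Multiset.sum_cons, Multiset.prod_cons]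
    rw [Complex.exp_add, Complex.exp_log (h a (Multiset.mem_cons_self a m)),
      ih fun z hz => h z (Multiset.mem_cons_of_mem hz)]

theorem exp_logDetOneSub_smul {n : ℕ} {A : Matrix (Fin n) (Fin n) ℂ} {c : ℂ}
    (hA : (1 - c • A).det ≠ 0) :
    Complex.exp ((A.charpoly.roots.map fun z => Complex.log (1 - c * z)).sum)
      = (1 - c • A).det := by
  rw [det_one_sub_smul_eq_prod_roots] at hA ⊢
  refine exp_multiset_sum_log _ _ fun z hz h0 => hA ?_
  exact Multiset.prod_eq_zero (Multiset.mem_map.2 ⟨z, hz, h0⟩)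

theorem exp_logDetOneSub {n : ℕ} {A : Matrix (Fin n) (Fin n) ℂ} (hA : (1 - A).det ≠ 0) :
    Complex.exp (logDetOneSub A) = (1 - A).det := by
  have := exp_logDetOneSub_smul (A := A) (c := 1) (by simpa using hA)
  simpa [logDetOneSub] using this

theorem continuous_eval_charpolyRev_derivative {n : ℕ} :
    Continuous fun q : Matrix (Fin n) (Fin n) ℂ × ℂ => q.1.charpolyRev.derivative.eval q.2 := by
  have hcoef : ∀ k, Continuous fun A : Matrix (Fin n) (Fin n) ℂ => A.charpolyRev.coeff k := by
    intro k
    have h1 : ∀ k, Continuous fun A : Matrix (Fin n) (Fin n) ℂ => A.charpoly.coeff k := by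
      intro k
      have h2 : ∀ A : Matrix (Fin n) (Fin n) ℂ, A.charpoly.coeff k =
          MvPolynomial.eval (fun ij : Fin n × Fin n => A ij.1 ij.2)
            ((Matrix.charpoly.univ ℂ (Fin n)).coeff k) := by
        intro A
        have := Matrix.charpoly.univ_coeff_eval₂Hom (Fin n) (RingHom.id ℂ)
          (fun ij : Fin n × Fin n => A ij.1 ij.2) k
        rw [show A = Matrix.of fun i j => A i j from rfl]
        exact this.symm
      simp_rw [h2]
      exact (MvPolynomial.continuous_eval _).comp (by fun_prop)
    simp_rw [← Matrix.reverse_charpoly, Polynomial.coeff_reverse,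
      Matrix.charpoly_natDegree_eq_dim]
    exact h1 _
  have hdeg : ∀ A : Matrix (Fin n) (Fin n) ℂ, A.charpolyRev.derivative.natDegree < n + 1 := by
    intro A
    refine Nat.lt_succ_of_le ((Polynomial.natDegree_derivative_le _).trans ?_)
    refine (Nat.sub_le _ _).trans ?_
    rw [← Matrix.reverse_charpoly]
    refine (Polynomial.reverse_natDegree_le _).trans ?_
    rw [Matrix.charpoly_natDegree_eq_dim, Fintype.card_fin]
  have h3 : ∀ q : Matrix (Fin n) (Fin n) ℂ × ℂ, q.1.charpolyRev.derivative.eval q.2 =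
      ∑ k ∈ Finset.range (n + 1), (q.1.charpolyRev.coeff (k + 1) * (k + 1)) * q.2 ^ k := by
    intro q
    rw [Polynomial.eval_eq_sum_range' (hdeg q.1)]
    simp_rw [Polynomial.coeff_derivative]
  simp_rw [h3]
  refine continuous_finsetSum _ fun k _ => ?_
  exact (((hcoef (k + 1)).comp continuous_fst).mul continuous_const).mul (continuous_snd.pow k)

/-- The sum of logarithms along `σA` exponentiates to the determinant, so its derivative is the
logarithmic derivative of the determinant. The integral no longer mentions eigenvalues, only
coefficients polynomial in the entries, which makes continuity in `A` accessible. -/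
theorem logDetOneSub_eq_integral {n : ℕ} {A : Matrix (Fin n) (Fin n) ℂ}
    (hA : ∀ σ ∈ Set.Icc (0 : ℝ) 1, (1 - (σ : ℂ) • A).det ≠ 0) :
    logDetOneSub A =
      ∫ σ in (0 : ℝ)..1, A.charpolyRev.derivative.eval (σ : ℂ) / (1 - (σ : ℂ) • A).det := by
  set S : ℝ → ℂ := fun x => (A.charpoly.roots.map fun z => Complex.log (1 - (x : ℂ) * z)).sum
    with hS
  have hderiv : ∀ σ ∈ Set.Icc (0 : ℝ) 1, HasDerivAt S
      (A.charpolyRev.derivative.eval (σ : ℂ) / (1 - (σ : ℂ) • A).det) σ := by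
    intro σ hσ
    have h1 := hasDerivAt_multiset_sum_log A.charpoly.roots σ
      fun z hz => one_sub_smul_root_mem_slitPlane hA hz hσ
    have h2 := h1.cexp
    have hexp : ∀ c : ℂ, (1 - c • A).det ≠ 0 → Complex.exp
        ((A.charpoly.roots.map fun z => Complex.log (1 - c * z)).sum) = (1 - c • A).det :=
      fun c hc => exp_logDetOneSub_smul hc
    have h3 : HasDerivAt (fun x : ℝ => (1 - (x : ℂ) • A).det)
        (A.charpolyRev.derivative.eval (σ : ℂ)) σ := by
      have h4 := (A.charpolyRev.hasDerivAt (σ : ℂ)).comp_ofReal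
      simpa only [eval_charpolyRev_eq_det] using h4
    have hev : (fun x : ℝ => Complex.exp (S x)) =ᶠ[nhds σ] fun x : ℝ => (1 - (x : ℂ) • A).det := by
      have hne := h3.continuousAt.eventually_ne (hA σ hσ)
      filter_upwards [hne] with x hx using hexp _ hx
    have h5 := h2.unique (h3.congr_of_eventuallyEq hev)
    rw [hexp _ (hA σ hσ)] at h5
    rw [← h5, mul_div_cancel_left₀ _ (hA σ hσ)]
    exact h1
  have hS1 : logDetOneSub A = S 1 - S 0 := by simp [hS, logDetOneSub]
  rw [hS1]
  symm
  refine intervalIntegral.integral_eq_sub_of_hasDerivAt ?_ ?_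
  · intro x hx
    rw [Set.uIcc_of_le zero_le_one] at hx
    exact hderiv x hx
  · refine ContinuousOn.intervalIntegrable ?_
    rw [Set.uIcc_of_le zero_le_one]
    refine ContinuousOn.div ?_ ?_ hA
    · exact (A.charpolyRev.derivative.continuous.comp Complex.continuous_ofReal).continuousOn
    · exact Continuous.continuousOn (by fun_prop)

theorem continuous_logDetOneSub {n : ℕ} {X : Type*} [TopologicalSpace X]
    {A : X → Matrix (Fin n) (Fin n) ℂ} (hc : Continuous A)
    (hA : ∀ x, ∀ σ ∈ Set.Icc (0 : ℝ) 1, (1 - (σ : ℂ) • A x).det ≠ 0) :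
    Continuous fun x => logDetOneSub (A x) := by
  -- The denominator is known to be nonzero only for `σ ∈ [0, 1]`; clamping `σ` makes the integrand
  -- continuous for all real `σ` without changing the integral.
  let pr : ℝ → ℝ := fun σ => (Set.projIcc (0 : ℝ) 1 zero_le_one σ : ℝ)
  have hpr : Continuous pr := continuous_subtype_val.comp continuous_projIcc
  have h1 : ∀ x, logDetOneSub (A x) = ∫ σ in (0 : ℝ)..1,
      (A x).charpolyRev.derivative.eval (pr σ : ℂ) / (1 - (pr σ : ℂ) • A x).det := by
    intro x
    rw [logDetOneSub_eq_integral (hA x)]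
    refine intervalIntegral.integral_congr fun σ hσ => ?_
    rw [Set.uIcc_of_le zero_le_one] at hσ
    simp only [pr, Set.projIcc_of_mem zero_le_one hσ]
  simp_rw [h1]
  refine intervalIntegral.continuous_parametric_intervalIntegral_of_continuous' ?_ 0 1
  refine Continuous.div ?_ ?_ fun q => hA q.1 _ (Set.projIcc (0 : ℝ) 1 zero_le_one q.2).2
  · exact continuous_eval_charpolyRev_derivative.comp
      (f := fun q : X × ℝ => (A q.1, (pr q.2 : ℂ))) (by fun_prop)
  · change Continuous fun q : X × ℝ => (1 - (pr q.2 : ℂ) • A q.1).det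
    fun_prop

end LogDet

/-! ### Schur complements of unitary matrices and splitting of the logarithm -/

section SchurTransfer

open Matrix

variable {n : ℕ}

/-- The compression of `A` to the last `n` coordinates after closing the loop through the first
one; `1 - schurTransfer A` is the Schur complement of the first entry of `1 - A`. -/
noncomputable def schurTransfer (A : Matrix (Fin (n + 1)) (Fin (n + 1)) ℂ) :
    Matrix (Fin n) (Fin n) ℂ :=
  Matrix.of fun i j => A i.succ j.succ + A i.succ 0 * (1 - A 0 0)⁻¹ * A 0 j.succ

theorem det_one_sub_eq_mul_det_schurTransfer (A : Matrix (Fin (n + 1)) (Fin (n + 1)) ℂ)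
    (h : A 0 0 ≠ 1) : (1 - A).det = (1 - A 0 0) * (1 - schurTransfer A).det := by
  have h1 : 1 - A 0 0 ≠ 0 := sub_ne_zero.2 h.symm
  let e : Fin n ⊕ Unit ≃ Fin (n + 1) :=
    ((finSuccEquiv n).trans (Equiv.optionEquivSumPUnit (Fin n))).symm
  have el : ∀ i, e (Sum.inl i) = i.succ := fun i => by simp [e]
  have er : ∀ i, e (Sum.inr i) = 0 := fun i => by simp [e]
  let D : Matrix Unit Unit ℂ := Matrix.of fun _ _ => 1 - A 0 0
  let D' : Matrix Unit Unit ℂ := Matrix.of fun _ _ => (1 - A 0 0)⁻¹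
  let _ : Invertible D := ⟨D', by ext; simp [D, D', Matrix.mul_apply, h1],
    by ext; simp [D, D', Matrix.mul_apply, h1]⟩
  have hD : ⅟D = D' := rfl
  have hb : (1 - A).submatrix e e = Matrix.fromBlocks
      (Matrix.of fun i j : Fin n => (1 - A) i.succ j.succ)
      (Matrix.of fun (i : Fin n) (_ : Unit) => (1 - A) i.succ 0)
      (Matrix.of fun (_ : Unit) (j : Fin n) => (1 - A) 0 j.succ) D := by
    ext i j
    rcases i with i | i <;> rcases j with j | j <;> simp [el, er, D]
  rw [← Matrix.det_submatrix_equiv_self e, hb, Matrix.det_fromBlocks₂₂, hD]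
  congr 1
  · simp [D]
  · congr 1
    ext i j
    simp only [D', Matrix.sub_apply, Matrix.of_apply, Matrix.mul_apply, Finset.univ_unique,
      Finset.sum_singleton, schurTransfer, Matrix.one_apply, Fin.succ_inj,
      (Fin.succ_ne_zero i), (Fin.succ_ne_zero j).symm, if_false]
    ring

/-- The coordinate `y` is chosen to be reproduced by `A`. It then contributes equally to both sides
of a norm or inner product comparison and cancels, so contractivity and unitarity pass from `A` to
`schurTransfer A`. -/
theorem mulVec_cons_eq_cons_schurTransfer (A : Matrix (Fin (n + 1)) (Fin (n + 1)) ℂ)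
    (h : A 0 0 ≠ 1) (x : Fin n → ℂ) : ∃ y : ℂ,
    A *ᵥ (Fin.cons y x : Fin (n + 1) → ℂ) = Fin.cons y (schurTransfer A *ᵥ x) := by
  have h1 : 1 - A 0 0 ≠ 0 := sub_ne_zero.2 h.symm
  refine ⟨(1 - A 0 0)⁻¹ * ∑ j, A 0 j.succ * x j, ?_⟩
  ext i
  rw [Matrix.mulVec, dotProduct, Fin.sum_univ_succ]
  refine Fin.cases ?_ (fun i => ?_) i
  · simp only [Fin.cons_zero, Fin.cons_succ]
    field_simp
    ring
  · simp only [Fin.cons_zero, Fin.cons_succ, schurTransfer, Matrix.mulVec, dotProduct,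
      Matrix.of_apply, add_mul, Finset.sum_add_distrib, Finset.mul_sum]
    rw [add_comm]
    congr 1
    refine Finset.sum_congr rfl fun j _ => ?_
    ring

/-- `A` does not increase the Euclidean norm. -/
def IsEuclideanContraction (A : Matrix (Fin n) (Fin n) ℂ) : Prop :=
  ∀ x : Fin n → ℂ, ∑ i, ‖(A *ᵥ x) i‖ ^ 2 ≤ ∑ i, ‖x i‖ ^ 2

theorem isEuclideanContraction_schurTransfer {A : Matrix (Fin (n + 1)) (Fin (n + 1)) ℂ}
    (hA : IsEuclideanContraction A) (h : A 0 0 ≠ 1) :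
    IsEuclideanContraction (schurTransfer A) := by
  intro x
  obtain ⟨y, hy⟩ := mulVec_cons_eq_cons_schurTransfer A h x
  have := hA (Fin.cons y x)
  rw [hy, Fin.sum_univ_succ, Fin.sum_univ_succ] at this
  simpa using this

theorem IsEuclideanContraction.smul {A : Matrix (Fin n) (Fin n) ℂ}
    (hA : IsEuclideanContraction A) {c : ℂ} (hc : ‖c‖ ≤ 1) : IsEuclideanContraction (c • A) := by
  intro x
  refine le_trans (Finset.sum_le_sum fun i _ => ?_) (hA x)
  rw [Matrix.smul_mulVec, Pi.smul_apply, smul_eq_mul, norm_mul, mul_pow]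
  have : ‖c‖ ^ 2 ≤ 1 := pow_le_one₀ (norm_nonneg c) hc
  nlinarith [sq_nonneg ‖(A *ᵥ x) i‖]

theorem IsEuclideanContraction.det_one_sub_smul_ne_zero {A : Matrix (Fin n) (Fin n) ℂ}
    (hA : IsEuclideanContraction A) {c : ℂ} (hc : ‖c‖ < 1) : (1 - c • A).det ≠ 0 := by
  intro h0
  obtain ⟨x, hx, hx0⟩ := Matrix.exists_mulVec_eq_zero_iff.2 h0
  rw [Matrix.sub_mulVec, Matrix.one_mulVec, sub_eq_zero, Matrix.smul_mulVec] at hx0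
  have h1 : ∑ i, ‖x i‖ ^ 2 = ‖c‖ ^ 2 * ∑ i, ‖(A *ᵥ x) i‖ ^ 2 := by
    conv_lhs => rw [hx0]
    rw [Finset.mul_sum]
    refine Finset.sum_congr rfl fun i _ => ?_
    rw [Pi.smul_apply, smul_eq_mul, norm_mul, mul_pow]
  have h2 : 0 < ∑ i, ‖x i‖ ^ 2 := by
    obtain ⟨i, hi⟩ := Function.ne_iff.1 hx
    refine Finset.sum_pos' (fun _ _ => by positivity) ⟨i, Finset.mem_univ i, ?_⟩
    have : 0 < ‖x i‖ := norm_pos_iff.2 hi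
    positivity
  have h3 := hA x
  have h4 : ‖c‖ ^ 2 < 1 := pow_lt_one₀ (norm_nonneg c) hc two_ne_zero
  nlinarith [sq_nonneg ‖c‖]

theorem star_mulVec_dotProduct_mulVec {A : Matrix (Fin n) (Fin n) ℂ}
    (hA : A ∈ Matrix.unitaryGroup (Fin n) ℂ) (x y : Fin n → ℂ) :
    star (A *ᵥ x) ⬝ᵥ (A *ᵥ y) = star x ⬝ᵥ y := by
  rw [Matrix.star_mulVec, Matrix.dotProduct_mulVec, Matrix.vecMul_vecMul,
    ← Matrix.star_eq_conjTranspose, Matrix.mem_unitaryGroup_iff'.1 hA, Matrix.vecMul_one]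

theorem star_dotProduct_self_eq_sum (x : Fin n → ℂ) :
    star x ⬝ᵥ x = ((∑ i, ‖x i‖ ^ 2 : ℝ) : ℂ) := by
  push_cast
  refine Finset.sum_congr rfl fun i _ => ?_
  rw [← Complex.conj_mul']
  rfl

theorem isEuclideanContraction_of_mem_unitaryGroup {A : Matrix (Fin n) (Fin n) ℂ}
    (hA : A ∈ Matrix.unitaryGroup (Fin n) ℂ) : IsEuclideanContraction A := by
  intro x
  have := star_mulVec_dotProduct_mulVec hA x x
  rw [star_dotProduct_self_eq_sum, star_dotProduct_self_eq_sum] at this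
  exact (Complex.ofReal_injective this).le

theorem schurTransfer_mem_unitaryGroup {A : Matrix (Fin (n + 1)) (Fin (n + 1)) ℂ}
    (hA : A ∈ Matrix.unitaryGroup (Fin (n + 1)) ℂ) (h : A 0 0 ≠ 1) :
    schurTransfer A ∈ Matrix.unitaryGroup (Fin n) ℂ := by
  have key : ∀ x x' : Fin n → ℂ,
      star (schurTransfer A *ᵥ x) ⬝ᵥ (schurTransfer A *ᵥ x') = star x ⬝ᵥ x' := by
    intro x x'
    obtain ⟨y, hy⟩ := mulVec_cons_eq_cons_schurTransfer A h x
    obtain ⟨y', hy'⟩ := mulVec_cons_eq_cons_schurTransfer A h x'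
    have := star_mulVec_dotProduct_mulVec hA (Fin.cons y x) (Fin.cons y' x')
    rw [hy, hy', dotProduct, dotProduct, Fin.sum_univ_succ, Fin.sum_univ_succ] at this
    simpa [dotProduct] using this
  rw [Matrix.mem_unitaryGroup_iff']
  ext i j
  have := key (Pi.single i 1) (Pi.single j 1)
  rw [Matrix.mulVec_single_one, Matrix.mulVec_single_one] at this
  rw [Matrix.mul_apply]
  simp only [dotProduct, Matrix.col_apply, Pi.star_apply] at this
  simp only [Matrix.star_apply]
  rw [this]
  simp [Matrix.one_apply, Pi.single_apply, eq_comm]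

theorem one_sub_re_pos {z : ℂ} (hz : ‖z‖ ≤ 1) (h1 : z ≠ 1) : 0 < (1 - z).re := by
  rw [Complex.sub_re, Complex.one_re, sub_pos]
  refine lt_of_le_of_ne ((Complex.re_le_norm _).trans hz) fun hr => h1 ?_
  have h2 := Complex.sq_norm z
  rw [Complex.normSq_apply, hr] at h2
  have h3 : z.im = 0 := by
    have : ‖z‖ ^ 2 ≤ 1 := pow_le_one₀ (norm_nonneg _) hz
    nlinarith [mul_self_nonneg z.im]
  exact Complex.ext hr h3

theorem isLocallyInjective_cexp : IsLocallyInjective Complex.exp := by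
  intro z
  refine ⟨{w | |w.im - z.im| < Real.pi}, isOpen_lt (by fun_prop) continuous_const,
    by simp [Real.pi_pos], fun x hx y hy hxy => ?_⟩
  have hx' := abs_lt.1 (Set.mem_ofPred_eq ▸ hx)
  have hy' := abs_lt.1 (Set.mem_ofPred_eq ▸ hy)
  have h := Complex.exp_inj_of_neg_pi_lt_of_le_pi (x := x - z.im * Complex.I)
    (y := y - z.im * Complex.I) (by simpa using hx'.1) (by simpa using hx'.2.le)
    (by simpa using hy'.1) (by simpa using hy'.2.le)
    (by rw [Complex.exp_sub, Complex.exp_sub, hxy])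
  exact sub_left_injective h

theorem det_one_sub_smul_ne_zero_of_isEuclideanContraction {A : Matrix (Fin n) (Fin n) ℂ}
    (hA : IsEuclideanContraction A) (h : (1 - A).det ≠ 0) :
    ∀ σ ∈ Set.Icc (0 : ℝ) 1, (1 - (σ : ℂ) • A).det ≠ 0 := by
  intro σ hσ
  rcases eq_or_lt_of_le hσ.2 with rfl | hlt
  · simpa using h
  · refine hA.det_one_sub_smul_ne_zero ?_
    rwa [Complex.norm_real, Real.norm_of_nonneg hσ.1]

theorem logDetOneSub_zero : logDetOneSub (0 : Matrix (Fin n) (Fin n) ℂ) = 0 := by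
  rw [logDetOneSub, Matrix.charpoly_zero, Polynomial.roots_X_pow]
  refine Multiset.sum_eq_zero fun w hw => ?_
  obtain ⟨z, hz, rfl⟩ := Multiset.mem_map.1 hw
  rw [Multiset.mem_singleton.1 (Multiset.mem_of_mem_nsmul hz)]
  simp

/-- The exponentials agree by the Schur factorization, which leaves an ambiguity in `2πiℤ`. It is
removed by following both sides along `τA`, `τ ∈ [0, 1]`, from `τ = 0`, where both vanish. The
matrices `τA` are contractions but not unitary, which is why contractions are the working class
here. -/
theorem logDetOneSub_eq_log_add_logDetOneSub_schurTransfer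
    {A : Matrix (Fin (n + 1)) (Fin (n + 1)) ℂ} (hA : A ∈ Matrix.unitaryGroup (Fin (n + 1)) ℂ)
    (h : A 0 0 ≠ 1) (hdet : (1 - A).det ≠ 0) :
    logDetOneSub A = Complex.log (1 - A 0 0) + logDetOneSub (schurTransfer A) := by
  have hc := isEuclideanContraction_of_mem_unitaryGroup hA
  have hnorm : ‖A 0 0‖ ≤ 1 := unitaryGroup_norm_entry_le_one ⟨A, hA⟩ 0 0
  have hA1 := det_one_sub_smul_ne_zero_of_isEuclideanContraction hc hdet
  let B : Set.Icc (0 : ℝ) 1 → Matrix (Fin (n + 1)) (Fin (n + 1)) ℂ := fun τ => ((τ : ℝ) : ℂ) • A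
  have hBn : ∀ τ : Set.Icc (0 : ℝ) 1, ‖((τ : ℝ) : ℂ)‖ ≤ 1 := fun τ => by
    rw [Complex.norm_real, Real.norm_of_nonneg τ.2.1]; exact τ.2.2
  have hB0 : ∀ τ, B τ 0 0 = ((τ : ℝ) : ℂ) * A 0 0 := fun τ => by simp [B]
  have hslit : ∀ τ, 1 - B τ 0 0 ∈ Complex.slitPlane := by
    intro τ
    rw [hB0]
    refine Or.inl ?_
    rw [Complex.sub_re, Complex.one_re, Complex.re_ofReal_mul, sub_pos]
    have hre : (A 0 0).re < 1 := by
      have := one_sub_re_pos hnorm h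
      rwa [Complex.sub_re, Complex.one_re, sub_pos] at this
    rcases le_or_gt (A 0 0).re 0 with hneg | hpos
    · nlinarith [τ.2.1]
    · nlinarith [τ.2.2]
  have hBne : ∀ τ, B τ 0 0 ≠ 1 := fun τ h1 => by
    have := Complex.slitPlane_ne_zero (hslit τ)
    rw [h1, sub_self] at this
    exact this rfl
  have hBc : ∀ τ, IsEuclideanContraction (B τ) := fun τ => hc.smul (hBn τ)
  have hBdet : ∀ τ, (1 - B τ).det ≠ 0 := fun τ => hA1 τ τ.2
  have hBH := fun τ => det_one_sub_smul_ne_zero_of_isEuclideanContraction (hBc τ) (hBdet τ)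
  have hTdet : ∀ τ, (1 - schurTransfer (B τ)).det ≠ 0 := by
    intro τ h0
    refine hBdet τ ?_
    rw [det_one_sub_eq_mul_det_schurTransfer _ (hBne τ), h0, mul_zero]
  have hTH := fun τ => det_one_sub_smul_ne_zero_of_isEuclideanContraction
    (isEuclideanContraction_schurTransfer (hBc τ) (hBne τ)) (hTdet τ)
  have hBcont : Continuous B := by fun_prop
  have hBel : ∀ i j, Continuous fun τ => B τ i j := fun i j => hBcont.matrix_elem i j
  have hinv : Continuous fun τ => (1 - B τ 0 0)⁻¹ :=
    (continuous_const.sub (hBel 0 0)).inv₀ fun τ => Complex.slitPlane_ne_zero (hslit τ)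
  have hTcont : Continuous fun τ => schurTransfer (B τ) := by
    refine continuous_matrix fun i j => ?_
    exact (hBel _ _).add (((hBel _ _).mul hinv).mul (hBel _ _))
  have hlog : Continuous fun τ => Complex.log (1 - B τ 0 0) :=
    (continuous_const.sub (hBel 0 0)).clog hslit
  have hsum : Continuous fun τ => Complex.log (1 - B τ 0 0) + logDetOneSub (schurTransfer (B τ)) :=
    hlog.add (continuous_logDetOneSub hTcont hTH)
  -- Two continuous lifts through `exp` on the connected interval `[0, 1]` that agree at one point
  -- are equal.
  have heq := T2Space.isSeparatedMap Complex.exp |>.eq_of_comp_eq isLocallyInjective_cexp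
    (continuous_logDetOneSub hBcont hBH)
    hsum (by
      funext τ
      simp only [Function.comp_apply]
      rw [Complex.exp_add, exp_logDetOneSub (hBdet τ), exp_logDetOneSub (hTdet τ),
        Complex.exp_log (Complex.slitPlane_ne_zero (hslit τ)),
        det_one_sub_eq_mul_det_schurTransfer _ (hBne τ)])
    ⟨0, by simp⟩ (by
      have hb : B ⟨0, by simp⟩ = 0 := by simp [B]
      have ht : schurTransfer (0 : Matrix (Fin (n + 1)) (Fin (n + 1)) ℂ) = 0 := by
        ext i j; simp [schurTransfer]
      simp only [hb, ht, logDetOneSub_zero]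
      simp)
  have h1 := congrFun heq ⟨1, by simp⟩
  have hb : B ⟨1, by simp⟩ = A := by simp [B]
  simpa only [hb] using h1

end SchurTransfer

/-! ### Independence of the two factors under Haar measure -/

section HaarRecursion

open Matrix

variable {n : ℕ}

/-- The block diagonal embedding `U ↦ 1 ⊕ U` of `U(n)` into `U(n + 1)`. -/
noncomputable def unitaryEmbed (U : Matrix.unitaryGroup (Fin n) ℂ) :
    Matrix.unitaryGroup (Fin (n + 1)) ℂ :=
  ⟨Matrix.of (Fin.cons (Fin.cons 1 0) fun i => Fin.cons 0 (U.1 i)), by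
    rw [Matrix.mem_unitaryGroup_iff]
    ext i j
    rw [Matrix.mul_apply, Fin.sum_univ_succ]
    refine Fin.cases ?_ (fun i => ?_) i <;> refine Fin.cases ?_ (fun j => ?_) j
    · simp [Matrix.star_apply]
    · simp [Matrix.star_apply, (Fin.succ_ne_zero j).symm]
    · simp [Matrix.star_apply, Fin.succ_ne_zero i]
    · have h := congrFun (congrFun (Matrix.mem_unitaryGroup_iff.1 U.2) i) j
      rw [Matrix.mul_apply] at h
      simpa [Matrix.star_apply, Matrix.one_apply] using h⟩

theorem unitaryEmbed_mul_zero (U : Matrix.unitaryGroup (Fin n) ℂ)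
    (V : Matrix.unitaryGroup (Fin (n + 1)) ℂ) (j : Fin (n + 1)) :
    ((unitaryEmbed U * V : Matrix.unitaryGroup (Fin (n + 1)) ℂ) :
      Matrix (Fin (n + 1)) (Fin (n + 1)) ℂ) 0 j = V.1 0 j := by
  simp [unitaryEmbed, Matrix.mul_apply, Fin.sum_univ_succ]

theorem unitaryEmbed_mul_succ (U : Matrix.unitaryGroup (Fin n) ℂ)
    (V : Matrix.unitaryGroup (Fin (n + 1)) ℂ) (i : Fin n) (j : Fin (n + 1)) :
    ((unitaryEmbed U * V : Matrix.unitaryGroup (Fin (n + 1)) ℂ) :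
      Matrix (Fin (n + 1)) (Fin (n + 1)) ℂ) i.succ j = ∑ k, U.1 i k * V.1 k.succ j := by
  simp [unitaryEmbed, Matrix.mul_apply, Fin.sum_univ_succ]

theorem continuous_unitaryEmbed : Continuous (unitaryEmbed (n := n)) := by
  refine Continuous.subtype_mk (continuous_matrix fun i j => ?_) _
  refine Fin.cases ?_ (fun i => ?_) i <;> refine Fin.cases ?_ (fun j => ?_) j
  · simpa using continuous_const
  · simpa using continuous_const
  · simpa using continuous_const
  · simpa using continuous_unitaryGroup_entry i j

/-- `1 ⊕ U` leaves the first row, and so the scalar `(1 - V₀₀)⁻¹`, untouched and acts linearly on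
the other rows. This remains true for `V₀₀ = 1`, where the inverse is `0`. -/
theorem schurTransfer_unitaryEmbed_mul (U : Matrix.unitaryGroup (Fin n) ℂ)
    (V : Matrix.unitaryGroup (Fin (n + 1)) ℂ) :
    schurTransfer ((unitaryEmbed U * V : Matrix.unitaryGroup (Fin (n + 1)) ℂ) :
      Matrix (Fin (n + 1)) (Fin (n + 1)) ℂ) = U.1 * schurTransfer V.1 := by
  ext i j
  rw [schurTransfer, Matrix.of_apply, unitaryEmbed_mul_succ, unitaryEmbed_mul_succ,
    unitaryEmbed_mul_zero, unitaryEmbed_mul_zero, Matrix.mul_apply, Finset.sum_mul,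
    Finset.sum_mul, ← Finset.sum_add_distrib]
  refine Finset.sum_congr rfl fun k _ => ?_
  rw [schurTransfer, Matrix.of_apply]
  ring

open Classical in
/-- `schurTransfer` as a map of unitary groups, defined to be `1` where the first entry is `1`. -/
noncomputable def schurUnitary (V : Matrix.unitaryGroup (Fin (n + 1)) ℂ) :
    Matrix.unitaryGroup (Fin n) ℂ :=
  if h : V.1 0 0 ≠ 1 then ⟨schurTransfer V.1, schurTransfer_mem_unitaryGroup V.2 h⟩ else 1

theorem measurable_schurUnitary : Measurable (schurUnitary (n := n)) := by
  refine measurable_of_restrict_of_restrict_compl (measurable_entry_ne_one 0 0) ?_ ?_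
  · have hval : Continuous fun V : {V : Matrix.unitaryGroup (Fin (n + 1)) ℂ | V.1 0 0 ≠ 1} =>
        V.1.1 := continuous_unitaryGroup_coe.comp continuous_subtype_val
    have hc : Continuous fun V : {V : Matrix.unitaryGroup (Fin (n + 1)) ℂ | V.1 0 0 ≠ 1} =>
        schurTransfer V.1.1 := by
      refine continuous_matrix fun i j => ?_
      refine (hval.matrix_elem _ _).add (((hval.matrix_elem _ _).mul ?_).mul
        (hval.matrix_elem _ _))
      exact (continuous_const.sub (hval.matrix_elem _ _)).inv₀ fun V => sub_ne_zero.2 (Ne.symm V.2)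
    have h2 := (hc.subtype_mk fun V => schurTransfer_mem_unitaryGroup V.1.2 V.2).measurable
    convert h2 using 1
    funext V
    have hV : V.1.1 0 0 ≠ 1 := V.2
    simp [schurUnitary, hV]
  · convert measurable_const (a := (1 : Matrix.unitaryGroup (Fin n) ℂ)) using 1
    funext V
    have hV : ¬ V.1.1 0 0 ≠ 1 := V.2
    exact dif_neg hV

theorem coe_schurUnitary {V : Matrix.unitaryGroup (Fin (n + 1)) ℂ} (h : V.1 0 0 ≠ 1) :
    (schurUnitary V).1 = schurTransfer V.1 := by
  rw [schurUnitary, dif_pos h]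

/-- `exp (a w + b w̄)`; for `w = log z` this is `z ^ a * conj z ^ b`. -/
noncomputable def expPair (a b w : ℂ) : ℂ :=
  Complex.exp (a * w + b * (starRingEnd ℂ) w)

theorem expPair_add (a b w z : ℂ) : expPair a b (w + z) = expPair a b w * expPair a b z := by
  rw [expPair, expPair, expPair, ← Complex.exp_add, map_add]
  ring_nf

theorem continuous_expPair (a b : ℂ) : Continuous (expPair a b) := by
  unfold expPair
  have := Complex.continuous_conj
  fun_prop

theorem aestronglyMeasurable_logDetOneSub (μ : Measure (Matrix.unitaryGroup (Fin n) ℂ))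
    [μ.IsHaarMeasure] [IsProbabilityMeasure μ] :
    AEStronglyMeasurable
      (fun V : Matrix.unitaryGroup (Fin n) ℂ => logDetOneSub V.1) μ := by
  have hc : ContinuousOn (fun V : Matrix.unitaryGroup (Fin n) ℂ => logDetOneSub V.1)
      {V | (1 - V.1).det ≠ 0} := by
    rw [continuousOn_iff_continuous_domRestrict]
    refine continuous_logDetOneSub (continuous_unitaryGroup_coe.comp continuous_subtype_val) ?_
    intro V
    exact det_one_sub_smul_ne_zero_of_isEuclideanContraction
      (isEuclideanContraction_of_mem_unitaryGroup V.1.2) V.2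
  have h := hc.aestronglyMeasurable (μ := μ) measurable_det_ne_zero
  have hr : μ.restrict {V | (1 - V.1).det ≠ 0} = μ :=
    Measure.restrict_eq_self_of_ae_mem (ae_det_one_sub_ne_zero μ)
  rwa [hr] at h

theorem measurePreserving_unitaryEmbed_mul (μ : Measure (Matrix.unitaryGroup (Fin (n + 1)) ℂ))
    [μ.IsHaarMeasure] [IsProbabilityMeasure μ] (ν : Measure (Matrix.unitaryGroup (Fin n) ℂ))
    [IsProbabilityMeasure ν] :
    MeasurePreserving (fun q : Matrix.unitaryGroup (Fin n) ℂ ×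
      Matrix.unitaryGroup (Fin (n + 1)) ℂ => unitaryEmbed q.1 * q.2) (ν.prod μ) μ := by
  have h1 : MeasurePreserving (fun q : Matrix.unitaryGroup (Fin n) ℂ ×
      Matrix.unitaryGroup (Fin (n + 1)) ℂ => (q.1, unitaryEmbed q.1 * q.2))
      (ν.prod μ) (ν.prod μ) := by
    refine (MeasurePreserving.id ν).skew_product (g := fun U V => unitaryEmbed U * V) ?_ ?_
    · have := continuous_unitaryEmbed (n := n)
      exact Continuous.measurable (by simp only [Function.uncurry_def]; fun_prop)
    · exact Filter.Eventually.of_forall fun U => map_mul_left_eq_self μ (unitaryEmbed U)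
  exact measurePreserving_snd.comp h1

/-- This is the independence: for each fixed `V`, right translation by `schurUnitary V` preserves
`ν`, so the conditional law of the product given `V` is always `ν`. -/
theorem measurePreserving_mul_schurUnitary (μ : Measure (Matrix.unitaryGroup (Fin (n + 1)) ℂ))
    [IsProbabilityMeasure μ] (ν : Measure (Matrix.unitaryGroup (Fin n) ℂ))
    [ν.IsHaarMeasure] [IsProbabilityMeasure ν] :
    MeasurePreserving (fun q : Matrix.unitaryGroup (Fin n) ℂ ×
      Matrix.unitaryGroup (Fin (n + 1)) ℂ => (q.2, q.1 * schurUnitary q.2))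
      (ν.prod μ) (μ.prod ν) := by
  have h1 : MeasurePreserving (fun q : Matrix.unitaryGroup (Fin (n + 1)) ℂ ×
      Matrix.unitaryGroup (Fin n) ℂ => (q.1, q.2 * schurUnitary q.1))
      (μ.prod ν) (μ.prod ν) := by
    refine (MeasurePreserving.id μ).skew_product (g := fun V U => U * schurUnitary V) ?_ ?_
    · exact measurable_snd.mul (measurable_schurUnitary.comp measurable_fst)
    · exact Filter.Eventually.of_forall fun V =>
        (measurePreserving_mul_right_of_compactSpace ν (schurUnitary V)).map_eq
  exact h1.comp Measure.measurePreserving_swap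

/-- Under `ν × μ`, the matrix `(1 ⊕ U) V` has law `μ`, and its integrand splits into a function of
`V₀₀` times a function of `U (T V)`. The pair `(V, U (T V))` has law `μ × ν`, so the integral
factors. -/
theorem integral_expPair_logDetOneSub_succ (a b : ℂ)
    (μ : Measure (Matrix.unitaryGroup (Fin (n + 1)) ℂ)) [μ.IsHaarMeasure] [IsProbabilityMeasure μ]
    (ν : Measure (Matrix.unitaryGroup (Fin n) ℂ)) [ν.IsHaarMeasure] [IsProbabilityMeasure ν]
    (hG : Integrable (fun V : Matrix.unitaryGroup (Fin (n + 1)) ℂ =>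
      expPair a b (Complex.log (1 - V.1 0 0))) μ)
    (hF : Integrable (fun U : Matrix.unitaryGroup (Fin n) ℂ =>
      expPair a b (logDetOneSub U.1)) ν) :
    Integrable (fun V : Matrix.unitaryGroup (Fin (n + 1)) ℂ =>
      expPair a b (logDetOneSub V.1)) μ ∧
    ∫ V : Matrix.unitaryGroup (Fin (n + 1)) ℂ, expPair a b (logDetOneSub V.1) ∂μ =
      (∫ V : Matrix.unitaryGroup (Fin (n + 1)) ℂ, expPair a b (Complex.log (1 - V.1 0 0)) ∂μ) *
      ∫ U : Matrix.unitaryGroup (Fin n) ℂ, expPair a b (logDetOneSub U.1) ∂ν := by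
  have hm := measurePreserving_unitaryEmbed_mul μ ν
  have hΨ := measurePreserving_mul_schurUnitary μ ν
  have hFm : AEStronglyMeasurable (fun V : Matrix.unitaryGroup (Fin (n + 1)) ℂ =>
      expPair a b (logDetOneSub V.1)) μ :=
    (continuous_expPair a b).comp_aestronglyMeasurable (aestronglyMeasurable_logDetOneSub μ)
  have hprod := hG.mul_prod hF
  have hae : (fun q : Matrix.unitaryGroup (Fin n) ℂ × Matrix.unitaryGroup (Fin (n + 1)) ℂ =>
      expPair a b (logDetOneSub (unitaryEmbed q.1 * q.2 : Matrix.unitaryGroup _ ℂ).1))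
      =ᵐ[ν.prod μ] fun q => expPair a b (Complex.log (1 - q.2.1 0 0)) *
        expPair a b (logDetOneSub (q.1 * schurUnitary q.2 : Matrix.unitaryGroup _ ℂ).1) := by
    have h1 := hm.quasiMeasurePreserving.ae (ae_det_one_sub_ne_zero μ)
    have h2 := (measurePreserving_snd (μ := ν) (ν := μ)).quasiMeasurePreserving.ae
      (ae_entry_ne_one μ 0 0)
    filter_upwards [h1, h2] with q hq1 hq2
    have h00 := unitaryEmbed_mul_zero q.1 q.2 0
    rw [logDetOneSub_eq_log_add_logDetOneSub_schurTransfer (unitaryEmbed q.1 * q.2).2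
      (by rw [h00]; exact hq2) hq1, h00, schurTransfer_unitaryEmbed_mul, expPair_add,
      ← coe_schurUnitary hq2]
    rfl
  constructor
  · rw [← hm.integrable_comp hFm]
    exact (hΨ.integrable_comp_of_integrable hprod).congr hae.symm
  · rw [← integral_prod_mul]
    calc _ = ∫ V : Matrix.unitaryGroup (Fin (n + 1)) ℂ, expPair a b (logDetOneSub V.1)
          ∂((ν.prod μ).map fun q => unitaryEmbed q.1 * q.2) := by rw [hm.map_eq]
      _ = _ := integral_map hm.measurable.aemeasurable (by rw [hm.map_eq]; exact hFm)
      _ = _ := integral_congr_ae hae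
      _ = ∫ z, expPair a b (Complex.log (1 - z.1.1 0 0)) * expPair a b (logDetOneSub z.2.1)
          ∂((ν.prod μ).map fun q => (q.2, q.1 * schurUnitary q.2)) :=
        (integral_map hΨ.measurable.aemeasurable
          (by rw [hΨ.map_eq]; exact hprod.aestronglyMeasurable)).symm
      _ = _ := by rw [hΨ.map_eq]

end HaarRecursion

/-! ### Gauss's summation theorem -/

section GaussSummation

open Filter Topology

/-- A form of Raabe's test. -/
theorem summable_and_tendsto_mul_of_raabe {B : ℕ → ℝ} (hB : ∀ k, 0 ≤ B k) {ε : ℝ} (hε : 0 < ε)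
    {K : ℕ} (h : ∀ k ≥ K, ε * B k ≤ k * B k - (k + 1 : ℕ) * B (k + 1)) :
    Summable B ∧ Tendsto (fun k : ℕ => (k : ℝ) * B k) atTop (𝓝 0) := by
  have hT0 : ∀ k : ℕ, 0 ≤ (k : ℝ) * B k := fun k => mul_nonneg k.cast_nonneg (hB k)
  have hsum : ∀ m : ℕ, ε * ∑ i ∈ Finset.range m, B (K + i) ≤
      K * B K - (K + m : ℕ) * B (K + m) := by
    intro m
    induction m with
    | zero => simp
    | succ m ih =>
      rw [Finset.sum_range_succ, mul_add]
      have := h (K + m) (Nat.le_add_right K m)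
      rw [← add_assoc]
      linarith
  have hS : Summable B := by
    rw [← summable_nat_add_iff K]
    refine summable_of_sum_range_le (c := K * B K / ε) (fun i => hB _) fun m => ?_
    rw [le_div_iff₀ hε, mul_comm]
    have h1 := hsum m
    have h2 := hT0 (K + m)
    simp_rw [add_comm _ K]
    linarith
  refine ⟨hS, ?_⟩
  have hanti : Antitone fun m : ℕ => ((m + K : ℕ) : ℝ) * B (m + K) := by
    refine antitone_nat_of_succ_le fun m => ?_
    have := h (m + K) (Nat.le_add_left K m)
    have h3 := mul_nonneg hε.le (hB (m + K))
    rw [show m + 1 + K = m + K + 1 by ring]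
    linarith
  have hbdd : BddBelow (Set.range fun m : ℕ => ((m + K : ℕ) : ℝ) * B (m + K)) :=
    ⟨0, by rintro _ ⟨m, rfl⟩; exact hT0 _⟩
  have hlim := tendsto_atTop_ciInf hanti hbdd
  set l := ⨅ m : ℕ, ((m + K : ℕ) : ℝ) * B (m + K) with hl
  have hl0 : 0 ≤ l := le_ciInf fun m => hT0 _
  have hle : ∀ m : ℕ, l ≤ ((m + K : ℕ) : ℝ) * B (m + K) := fun m => ciInf_le hbdd m
  rw [← tendsto_add_atTop_iff_nat K]
  rcases hl0.eq_or_lt with h0 | hpos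
  · rw [h0]; exact hlim
  -- A positive limit `l` would give `B k ≥ l / k` from some index on, against summability.
  · exfalso
    have hsK : Summable fun m : ℕ => B (m + (K + 1)) := (summable_nat_add_iff (K + 1)).2 hS
    have h4 : Summable fun m : ℕ => l * ((m + (K + 1) : ℕ) : ℝ)⁻¹ := by
      refine Summable.of_nonneg_of_le (fun m => by positivity) (fun m => ?_) hsK
      have h5 := hle (m + 1)
      rw [show m + 1 + K = m + (K + 1) by ring] at h5
      rw [← div_eq_mul_inv, div_le_iff₀ (by positivity), mul_comm]
      exact h5
    have h6 := (summable_mul_left_iff hpos.ne').1 h4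
    rw [summable_nat_add_iff (f := fun m : ℕ => (m : ℝ)⁻¹) (K + 1)] at h6
    exact Real.not_summable_natCast_inv h6

/-- The terms of the hypergeometric series `₂F₁(-a, -b; N; 1)`. -/
noncomputable def gaussTerm (a b : ℂ) (N k : ℕ) : ℂ :=
  ∏ j ∈ Finset.range k, (((j : ℂ) - a) * (j - b) / ((j + 1) * (j + N)))

theorem gaussTerm_succ (a b : ℂ) (N k : ℕ) :
    gaussTerm a b N (k + 1) = gaussTerm a b N k * ((k - a) * (k - b) / ((k + 1) * (k + N))) := by
  rw [gaussTerm, Finset.prod_range_succ, gaussTerm]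

variable {a b : ℂ} {N : ℕ}

/-- Raabe's test: `|k - a| |k - b| ≤ k² - k Re(a+b) + C` by the arithmetic-geometric mean, so
dividing by `k + N` leaves `k - δ + O(1/k)` with `δ = N + Re(a+b) > 0`. Half of `δ` absorbs the
error for large `k`. -/
theorem summable_gaussTerm_and_tendsto (hN : 1 ≤ N) (hab : -1 < (a + b).re) :
    Summable (fun k => ‖gaussTerm a b N k‖) ∧
      Tendsto (fun k : ℕ => (k : ℝ) * ‖gaussTerm a b N k‖) atTop (𝓝 0) := by
  have hN' : (1 : ℝ) ≤ N := by exact_mod_cast hN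
  rw [Complex.add_re] at hab
  set δ : ℝ := N + (a.re + b.re) with hδ
  have hδ0 : 0 < δ := by linarith
  set C : ℝ := (‖a‖ ^ 2 + ‖b‖ ^ 2) / 2 with hC
  obtain ⟨K, hK⟩ := exists_nat_ge ((C + N * δ) / (δ / 2))
  refine summable_and_tendsto_mul_of_raabe (fun k => norm_nonneg _) (half_pos hδ0) (K := K)
    fun k hk => ?_
  have hkK : (C + N * δ) ≤ k * (δ / 2) := by
    rw [div_le_iff₀ (half_pos hδ0)] at hK
    have : (K : ℝ) ≤ k := by exact_mod_cast hk
    nlinarith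
  rw [gaussTerm_succ]
  set B := ‖gaussTerm a b N k‖ with hB
  have hk0 : (0 : ℝ) ≤ k := k.cast_nonneg
  have hB0 : 0 ≤ B := norm_nonneg _
  have hsq : ∀ a : ℂ, ‖(k : ℂ) - a‖ ^ 2 = k ^ 2 - 2 * k * a.re + ‖a‖ ^ 2 := by
    intro a
    rw [Complex.sq_norm, Complex.sq_norm, Complex.normSq_apply, Complex.normSq_apply]
    simp only [Complex.sub_re, Complex.natCast_re, Complex.sub_im, Complex.natCast_im]
    ring
  have hprod : ‖(k : ℂ) - a‖ * ‖(k : ℂ) - b‖ ≤ k ^ 2 - k * (a.re + b.re) + C := by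
    have h1 := hsq a
    have h2 := hsq b
    nlinarith [sq_nonneg (‖(k : ℂ) - a‖ - ‖(k : ℂ) - b‖)]
  have hkN : (0 : ℝ) < k + N := by linarith
  have hnorm : ‖gaussTerm a b N k * ((k - a) * (k - b) / ((k + 1) * (k + N)))‖ =
      B * (‖(k : ℂ) - a‖ * ‖(k : ℂ) - b‖ / ((k + 1) * (k + N))) := by
    have e1 : ‖(k : ℂ) + 1‖ = (k : ℝ) + 1 := by
      rw [← Nat.cast_one, ← Nat.cast_add, Complex.norm_natCast]; push_cast; rfl
    have e2 : ‖(k : ℂ) + N‖ = (k : ℝ) + N := by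
      rw [← Nat.cast_add, Complex.norm_natCast]; push_cast; rfl
    rw [norm_mul, norm_div, norm_mul, norm_mul, e1, e2]
  rw [hnorm]
  have h3 : ((k + 1 : ℕ) : ℝ) * (B * (‖(k : ℂ) - a‖ * ‖(k : ℂ) - b‖ / ((k + 1) * (k + N)))) =
      B * (‖(k : ℂ) - a‖ * ‖(k : ℂ) - b‖ / (k + N)) := by
    have : (k : ℝ) + 1 ≠ 0 := by positivity
    push_cast
    field_simp
  have h4 : ‖(k : ℂ) - a‖ * ‖(k : ℂ) - b‖ / (k + N) ≤ k - δ / 2 := by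
    rw [div_le_iff₀ hkN]
    nlinarith
  rw [h3]
  nlinarith [mul_le_mul_of_nonneg_left h4 hB0]

theorem gaussTerm_succ_right (a b : ℂ) (hN : 1 ≤ N) (k : ℕ) :
    gaussTerm a b (N + 1) k * (N + k) = gaussTerm a b N k * N := by
  have hpos : ∀ m : ℕ, ((m : ℂ) + N) ≠ 0 := fun m => by
    rw [← Nat.cast_add]; exact Nat.cast_ne_zero.2 (by omega)
  induction k with
  | zero => simp [gaussTerm]
  | succ k ih =>
    rw [gaussTerm_succ, gaussTerm_succ]
    have h1 := hpos k
    have h2 := hpos (k + 1)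
    have h3 : (k : ℂ) + 1 ≠ 0 := Nat.cast_add_one_ne_zero k
    push_cast at h2 ⊢
    have h4 : (N : ℂ) + k ≠ 0 := by rwa [add_comm]
    have h5 : (k : ℂ) + (N + 1) ≠ 0 := by convert h2 using 1; ring
    have h6 : gaussTerm a b (N + 1) k = gaussTerm a b N k * N / (N + k) := by
      rw [← ih]; field_simp
    rw [h6]
    field_simp
    ring

/-- A contiguity relation: the termwise difference of the two sides is the telescoping difference of
`N k c_k`, with `c_k` the term at `N`, and the boundary term tends to `0` by the Raabe estimate. -/
theorem tsum_gaussTerm_succ_right (hN : 1 ≤ N) (hab : -1 < (a + b).re) :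
    (N : ℂ) * (N + a + b) * ∑' k, gaussTerm a b N k =
      (N + a) * (N + b) * ∑' k, gaussTerm a b (N + 1) k := by
  obtain ⟨hs, ht⟩ := summable_gaussTerm_and_tendsto hN hab
  have hs' := (summable_gaussTerm_and_tendsto (Nat.le_succ_of_le hN) hab).1
  have hpos : ∀ m : ℕ, ((m : ℂ) + N) ≠ 0 := fun m => by
    rw [← Nat.cast_add]; exact Nat.cast_ne_zero.2 (by omega)
  have hterm : ∀ k : ℕ, (N : ℂ) * (N + a + b) * gaussTerm a b N k -
      (N + a) * (N + b) * gaussTerm a b (N + 1) k =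
      N * (k * gaussTerm a b N k) - N * ((k + 1 : ℕ) * gaussTerm a b N (k + 1)) := by
    intro k
    have h1 := hpos k
    have h4 : (N : ℂ) + k ≠ 0 := by rwa [add_comm]
    have h3 : (k : ℂ) + 1 ≠ 0 := Nat.cast_add_one_ne_zero k
    have h6 : gaussTerm a b (N + 1) k = gaussTerm a b N k * N / (N + k) := by
      rw [← gaussTerm_succ_right a b hN k]; field_simp
    rw [h6, gaussTerm_succ]
    push_cast
    field_simp
    ring
  have hsum : HasSum (fun k : ℕ => (N : ℂ) * (N + a + b) * gaussTerm a b N k -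
      (N + a) * (N + b) * gaussTerm a b (N + 1) k)
      ((N : ℂ) * (N + a + b) * ∑' k, gaussTerm a b N k -
      (N + a) * (N + b) * ∑' k, gaussTerm a b (N + 1) k) :=
    (hs.of_norm.hasSum.mul_left _).sub (hs'.of_norm.hasSum.mul_left _)
  have hlim := hsum.tendsto_sum_nat
  have hT : Tendsto (fun k : ℕ => (k : ℂ) * gaussTerm a b N k) atTop (𝓝 0) := by
    rw [tendsto_zero_iff_norm_tendsto_zero]
    simpa using ht
  have hlim2 : Tendsto (fun m : ℕ => ∑ k ∈ Finset.range m,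
      ((N : ℂ) * (N + a + b) * gaussTerm a b N k -
      (N + a) * (N + b) * gaussTerm a b (N + 1) k)) atTop (𝓝 0) := by
    simp_rw [hterm]
    have : ∀ m : ℕ, ∑ k ∈ Finset.range m, ((N : ℂ) * (k * gaussTerm a b N k) -
        N * ((k + 1 : ℕ) * gaussTerm a b N (k + 1))) = -(N * (m * gaussTerm a b N m)) := by
      intro m
      rw [Finset.sum_range_sub' (fun k : ℕ => (N : ℂ) * (k * gaussTerm a b N k))]
      simp
    simp_rw [this]
    simpa using (hT.const_mul (N : ℂ)).neg
  exact sub_eq_zero.1 (tendsto_nhds_unique hlim hlim2)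

/-- Raising the lower parameter sends every term except the zeroth, which is `1`, to `0`; the terms
only shrink in norm, so those at `N` dominate. -/
theorem tendsto_tsum_gaussTerm (hN : 1 ≤ N) (hab : -1 < (a + b).re) :
    Tendsto (fun m : ℕ => ∑' k, gaussTerm a b (N + m) k) atTop (𝓝 1) := by
  have h1 : (1 : ℂ) = ∑' k : ℕ, if k = 0 then 1 else 0 := by simp
  rw [h1]
  refine tendsto_tsum_of_dominated_convergence (summable_gaussTerm_and_tendsto hN hab).1 ?_ ?_
  · intro k
    rcases k with _ | k
    · simp [gaussTerm]
    · simp only [Nat.succ_ne_zero, if_false]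
      have hz : Tendsto (fun m : ℕ => ∏ j ∈ Finset.range (k + 1),
          (((j : ℂ) - a) * (j - b) / (j + 1)) * (((j : ℂ) + (N + m : ℕ)))⁻¹) atTop
          (𝓝 (∏ j ∈ Finset.range (k + 1), (((j : ℂ) - a) * (j - b) / (j + 1)) * 0)) := by
        refine tendsto_finsetProd _ fun j _ => Tendsto.const_mul _ ?_
        have := (tendsto_inv_atTop_nhds_zero_nat (𝕜 := ℂ)).comp
          (tendsto_add_atTop_nat (j + N))
        refine this.congr fun m => ?_
        simp only [Function.comp_apply]
        congr 1
        push_cast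
        ring
      simp only [mul_zero, Finset.prod_const, Finset.card_range, ne_eq, Nat.add_eq_zero_iff,
        one_ne_zero, and_false, not_false_eq_true, zero_pow] at hz
      refine hz.congr fun m => ?_
      rw [gaussTerm]
      refine Finset.prod_congr rfl fun j _ => ?_
      rw [← div_eq_mul_inv, div_div]
  · refine Eventually.of_forall fun m k => ?_
    rw [gaussTerm, gaussTerm, norm_prod, norm_prod]
    refine Finset.prod_le_prod (fun _ _ => norm_nonneg _) fun j _ => ?_
    rw [norm_div, norm_div]
    have e : ∀ M : ℕ, ‖((j : ℂ) + 1) * (j + (M : ℂ))‖ = ((j : ℝ) + 1) * (j + M) := by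
      intro M
      rw [show ((j : ℂ) + 1) * (j + (M : ℂ)) = (((j + 1) * (j + M) : ℕ) : ℂ) by push_cast; rfl,
        Complex.norm_natCast]
      push_cast
      rfl
    rw [e, e]
    have hN' : (1 : ℝ) ≤ N := by exact_mod_cast hN
    push_cast
    gcongr
    linarith [(Nat.cast_nonneg m : (0 : ℝ) ≤ m)]

/-- **Gauss's summation theorem** for a positive integer lower parameter. -/
theorem tsum_gaussTerm (hN : 1 ≤ N) (ha : -1 / 2 < a.re) (hb : -1 / 2 < b.re) :
    ∑' k, gaussTerm a b N k = Complex.Gamma N * Complex.Gamma (N + a + b) /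
      (Complex.Gamma (N + a) * Complex.Gamma (N + b)) := by
  have hab : -1 < (a + b).re := by rw [Complex.add_re]; linarith
  have hN' : (1 : ℝ) ≤ N := by exact_mod_cast hN
  have hne : ∀ (s : ℂ), -1 < s.re → ∀ j : ℕ, (N : ℂ) + s + j ≠ 0 := by
    intro s hs j h0
    have := congrArg Complex.re h0
    simp only [Complex.add_re, Complex.natCast_re, Complex.zero_re] at this
    linarith [(Nat.cast_nonneg j : (0 : ℝ) ≤ j)]
  have ha' : -1 < a.re := by linarith
  have hb' : -1 < b.re := by linarith
  have hrec : ∀ m : ℕ, ∑' k, gaussTerm a b N k =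
      (∏ j ∈ Finset.range m, ((N + a + j) * (N + b + j) / ((N + 0 + j) * (N + (a + b) + j)))) *
        ∑' k, gaussTerm a b (N + m) k := by
    intro m
    induction m with
    | zero => simp
    | succ m ih =>
      rw [ih, Finset.prod_range_succ]
      have h := tsum_gaussTerm_succ_right (a := a) (b := b) (N := N + m) (by omega) hab
      have h1 := hne 0 (by norm_num) m
      have h2 := hne (a + b) hab m
      rw [mul_assoc]
      congr 1
      rw [div_mul_eq_mul_div, eq_div_iff (mul_ne_zero h1 h2)]
      push_cast at h
      rw [← add_assoc]
      linear_combination h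
  -- The product of the contiguity factors is a ratio of Euler's approximants to `Γ`: the factorials
  -- cancel, and so do the powers of `m`, as `0 + (a + b) = a + b`. Writing `N + 0` gives all four
  -- parameters one shape.
  have hseq : ∀ m : ℕ, m ≠ 0 → ∏ j ∈ Finset.range (m + 1),
      ((N + a + j) * (N + b + j) / ((N + 0 + j) * (N + (a + b) + j))) =
      Complex.GammaSeq (N + 0) m * Complex.GammaSeq (N + (a + b)) m /
        (Complex.GammaSeq (N + a) m * Complex.GammaSeq (N + b) m) := by
    intro m hm
    have hm' : (m : ℂ) ≠ 0 := Nat.cast_ne_zero.2 hm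
    have hf : (m.factorial : ℂ) ≠ 0 := Nat.cast_ne_zero.2 m.factorial_ne_zero
    have hp : ∀ (s : ℂ), -1 < s.re → ∏ j ∈ Finset.range (m + 1), ((N : ℂ) + s + j) ≠ 0 :=
      fun s hs => Finset.prod_ne_zero_iff.2 fun j _ => hne s hs j
    have h1 := hp 0 (by norm_num)
    have h2 := hp _ hab
    have h3 := hp _ ha'
    have h4 := hp _ hb'
    have hpow : (m : ℂ) ^ ((N : ℂ) + 0) * (m : ℂ) ^ ((N : ℂ) + (a + b)) =
        (m : ℂ) ^ ((N : ℂ) + a) * (m : ℂ) ^ ((N : ℂ) + b) := by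
      rw [← Complex.cpow_add _ _ hm', ← Complex.cpow_add _ _ hm']
      congr 1
      ring
    have h5 : (m : ℂ) ^ ((N : ℂ) + a) ≠ 0 := by simp [Complex.cpow_eq_zero_iff, hm']
    have h6 : (m : ℂ) ^ ((N : ℂ) + b) ≠ 0 := by simp [Complex.cpow_eq_zero_iff, hm']
    simp only [Complex.GammaSeq]
    rw [Finset.prod_div_distrib, Finset.prod_mul_distrib, Finset.prod_mul_distrib]
    rw [div_eq_div_iff (mul_ne_zero h1 h2) (by positivity)]
    field_simp
    linear_combination -hpow
  have hΓ : ∀ s : ℂ, -1 < s.re → Complex.Gamma (N + s) ≠ 0 := by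
    intro s hs
    refine Complex.Gamma_ne_zero_of_re_pos ?_
    simp only [Complex.add_re, Complex.natCast_re]
    linarith
  have hlim : Tendsto (fun m : ℕ => (∏ j ∈ Finset.range (m + 1),
      ((N + a + j) * (N + b + j) / ((N + 0 + j) * (N + (a + b) + j)))) *
        ∑' k, gaussTerm a b (N + (m + 1)) k) atTop
      (𝓝 (Complex.Gamma (N + 0) * Complex.Gamma (N + (a + b)) /
      (Complex.Gamma (N + a) * Complex.Gamma (N + b)) * 1)) := by
    refine Tendsto.mul ?_ ((tendsto_tsum_gaussTerm hN hab).comp (tendsto_add_atTop_nat 1))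
    have := ((Complex.GammaSeq_tendsto_Gamma (N + 0)).mul
      (Complex.GammaSeq_tendsto_Gamma (N + (a + b)))).div
      ((Complex.GammaSeq_tendsto_Gamma (N + a)).mul (Complex.GammaSeq_tendsto_Gamma (N + b)))
      (mul_ne_zero (hΓ a ha') (hΓ b hb'))
    refine this.congr' ?_
    filter_upwards [eventually_ne_atTop 0] with m hm using (hseq m hm).symm
  have hconst := tendsto_nhds_unique
    (tendsto_const_nhds.congr fun m => hrec (m + 1)) hlim
  rw [hconst, add_zero, mul_one, add_assoc]

end GaussSummation

/-! ### Moments of a matrix entry -/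

section EntryMoments

open Matrix

variable {n : ℕ}

theorem integrable_of_continuous_unitaryGroup {E : Type*} [NormedAddCommGroup E]
    [SecondCountableTopologyEither (Matrix.unitaryGroup (Fin n) ℂ) E]
    (μ : Measure (Matrix.unitaryGroup (Fin n) ℂ)) [IsProbabilityMeasure μ]
    {f : Matrix.unitaryGroup (Fin n) ℂ → E} (hf : Continuous f) : Integrable f μ :=
  hf.integrable_of_hasCompactSupport (HasCompactSupport.of_compactSpace f)

theorem integral_entry_pow_mul_conj_pow_eq_zero (μ : Measure (Matrix.unitaryGroup (Fin n) ℂ))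
    [μ.IsHaarMeasure] [IsProbabilityMeasure μ] (p q : Fin n) {j k : ℕ} (hjk : j ≠ k) :
    ∫ V : Matrix.unitaryGroup (Fin n) ℂ,
      V.1 p q ^ j * (starRingEnd ℂ) (V.1 p q) ^ k ∂μ = 0 := by
  have hjk' : (j : ℝ) - k ≠ 0 := sub_ne_zero.2 (by exact_mod_cast hjk)
  -- Rotation by this angle multiplies the integrand by `e^{i(j-k)x} = -1`.
  set x : ℝ := Real.pi / (j - k) with hx
  have h := integral_mul_left_eq_self (μ := μ) (fun V : Matrix.unitaryGroup (Fin n) ℂ =>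
      V.1 p q ^ j * (starRingEnd ℂ) (V.1 p q) ^ k) (unitaryScalar n (Circle.exp x))
  have hc : (Circle.exp x : ℂ) ^ j * (starRingEnd ℂ) (Circle.exp x : ℂ) ^ k = -1 := by
    rw [Circle.coe_exp, ← Complex.exp_conj, ← Complex.exp_nat_mul, ← Complex.exp_nat_mul,
      ← Complex.exp_add, ← Complex.exp_pi_mul_I]
    congr 1
    simp only [map_mul, Complex.conj_ofReal, Complex.conj_I]
    have : (Real.pi : ℂ) = (x * (j - k) : ℝ) := by rw [hx, div_mul_cancel₀ _ hjk']
    rw [this]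
    push_cast
    ring
  have h2 : ∀ V : Matrix.unitaryGroup (Fin n) ℂ,
      (unitaryScalar n (Circle.exp x) * V).1 p q ^ j *
        (starRingEnd ℂ) ((unitaryScalar n (Circle.exp x) * V).1 p q) ^ k =
      -(V.1 p q ^ j * (starRingEnd ℂ) (V.1 p q) ^ k) := by
    intro V
    have h3 := congrFun (congrFun (unitaryScalar_mul_coe (Circle.exp x) V) p) q
    rw [h3, Matrix.smul_apply, smul_eq_mul, map_mul, mul_pow, mul_pow, ← neg_one_mul, ← hc]
    ring
  simp_rw [h2] at h
  rw [integral_neg] at h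
  exact self_eq_neg.1 h.symm

/-- The Householder reflection along a unit vector. -/
noncomputable def householder (v : Fin n → ℂ) (hv : star v ⬝ᵥ v = 1) :
    Matrix.unitaryGroup (Fin n) ℂ :=
  ⟨1 - (2 : ℂ) • Matrix.vecMulVec v (star v), by
    rw [Matrix.mem_unitaryGroup_iff]
    have h1 : star (Matrix.vecMulVec v (star v)) = Matrix.vecMulVec v (star v) := by
      rw [Matrix.star_eq_conjTranspose, Matrix.conjTranspose_vecMulVec, star_star]
    have h2 : Matrix.vecMulVec v (star v) * Matrix.vecMulVec v (star v)
        = Matrix.vecMulVec v (star v) := by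
      rw [Matrix.vecMulVec_mul_vecMulVec, hv, one_smul]
    rw [star_sub, star_one, star_smul, h1, sub_mul, mul_sub, mul_sub, smul_mul_smul_comm, h2,
      one_mul, mul_one, one_mul]
    have : star (2 : ℂ) = 2 := by simp
    rw [this]
    module⟩

theorem householder_mul_apply (v : Fin n → ℂ) (hv : star v ⬝ᵥ v = 1)
    (V : Matrix.unitaryGroup (Fin n) ℂ) (p q : Fin n) :
    (householder v hv * V).1 p q = V.1 p q - 2 * v p * ∑ k, star (v k) * V.1 k q := by
  change ((1 - (2 : ℂ) • Matrix.vecMulVec v (star v)) * V.1) p q = _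
  rw [Matrix.sub_mul, Matrix.one_mul, Matrix.smul_mul, Matrix.vecMulVec_mul]
  simp only [Matrix.sub_apply, Matrix.smul_apply, Matrix.vecMulVec_apply, Matrix.vecMul,
    dotProduct, smul_eq_mul, Pi.star_apply]
  ring

/-- Invariance of Haar measure under plane rotations of two rows. -/
theorem integral_comp_rotate_rows (μ : Measure (Matrix.unitaryGroup (Fin n) ℂ))
    [μ.IsHaarMeasure] [IsProbabilityMeasure μ] {p r : Fin n} (hpr : p ≠ r) (q : Fin n)
    (f : ℂ → ℂ → ℂ) {ω : ℂ} (hω : ‖ω‖ = 1) (x : ℝ) :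
    ∫ V : Matrix.unitaryGroup (Fin n) ℂ,
      f (-(Real.cos x * V.1 p q + Real.sin x * ω * V.1 r q))
        (Real.cos x * V.1 r q - Real.sin x * (starRingEnd ℂ) ω * V.1 p q) ∂μ =
    ∫ V : Matrix.unitaryGroup (Fin n) ℂ, f (V.1 p q) (V.1 r q) ∂μ := by
  set c : ℝ := Real.cos (x / 2) with hc
  set s : ℝ := Real.sin (x / 2) with hs
  have hcs : c ^ 2 + s ^ 2 = 1 := by rw [hc, hs]; exact Real.cos_sq_add_sin_sq _
  have hcx : Real.cos x = 2 * c ^ 2 - 1 := by rw [hc, ← Real.cos_two_mul]; ring_nf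
  have hsx : Real.sin x = 2 * s * c := by rw [hc, hs, ← Real.sin_two_mul]; ring_nf
  have hωω : (starRingEnd ℂ) ω * ω = 1 := by rw [Complex.conj_mul', hω]; simp
  have hcsC : (c : ℂ) ^ 2 + (s : ℂ) ^ 2 = 1 := by exact_mod_cast hcs
  -- A reflection doubles the angle of its axis, hence the half-angles; that it is not a rotation
  -- accounts for the sign in the first argument of `f`.
  let v : Fin n → ℂ := Pi.single p (c : ℂ) + Pi.single r ((s : ℂ) * (starRingEnd ℂ) ω)
  have hsum : ∀ g : Fin n → ℂ, ∑ k, star (v k) * g k = c * g p + s * ω * g r := by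
    intro g
    simp [v, add_mul, Finset.sum_add_distrib, Pi.single_apply, apply_ite (starRingEnd ℂ)]
  have hvp : v p = c := by simp [v, hpr]
  have hvr : v r = s * (starRingEnd ℂ) ω := by simp [v, hpr.symm]
  have hv : star v ⬝ᵥ v = 1 := by
    have := hsum v
    rw [hvp, hvr] at this
    change ∑ k, star (v k) * v k = 1
    rw [this]
    linear_combination hcsC + (s : ℂ) ^ 2 * hωω
  rw [← integral_mul_left_eq_self (μ := μ) (fun V : Matrix.unitaryGroup (Fin n) ℂ =>
    f (V.1 p q) (V.1 r q)) (householder v hv)]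
  refine integral_congr_ae (Filter.Eventually.of_forall fun V => ?_)
  simp only
  rw [householder_mul_apply, householder_mul_apply, hsum fun k => V.1 k q, hvp, hvr, hcx, hsx]
  congr 1
  · push_cast; ring
  · push_cast
    linear_combination (2 * (s : ℂ) ^ 2 * V.1 r q) * hωω + 2 * V.1 r q * hcsC

/-- The integral of `u^(k+1) ū^k w̄`, with `u`, `w` the entries in rows `p`, `r`, does not change
when the rows are rotated. Its derivative at angle `0` gives `ω(k+1)P + ω̄Q - ωM = 0` for every
phase `ω`, and two phases suffice to eliminate the unwanted `Q`. -/
theorem integral_normSq_pow_mul_normSq (μ : Measure (Matrix.unitaryGroup (Fin n) ℂ))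
    [μ.IsHaarMeasure] [IsProbabilityMeasure μ] {p r : Fin n} (hpr : p ≠ r) (q : Fin n) (k : ℕ) :
    (k + 1 : ℂ) * ∫ V : Matrix.unitaryGroup (Fin n) ℂ,
      V.1 p q ^ k * (starRingEnd ℂ) (V.1 p q) ^ k * (V.1 r q * (starRingEnd ℂ) (V.1 r q)) ∂μ =
    ∫ V : Matrix.unitaryGroup (Fin n) ℂ,
      V.1 p q ^ (k + 1) * (starRingEnd ℂ) (V.1 p q) ^ (k + 1) ∂μ := by
  have hp := continuous_unitaryGroup_entry p q
  have hr := continuous_unitaryGroup_entry r q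
  have hconj := Complex.continuous_conj
  have hpc := hconj.comp hp
  have hrc := hconj.comp hr
  obtain ⟨P, hP⟩ : ∃ P : ℂ, P = ∫ V : Matrix.unitaryGroup (Fin n) ℂ,
        V.1 p q ^ k * (starRingEnd ℂ) (V.1 p q) ^ k * (V.1 r q * (starRingEnd ℂ) (V.1 r q)) ∂μ := ⟨_, rfl⟩
  obtain ⟨Q, hQ⟩ : ∃ Q : ℂ, Q = ∫ V : Matrix.unitaryGroup (Fin n) ℂ,
        V.1 p q ^ (k + 1) * (k * (starRingEnd ℂ) (V.1 p q) ^ (k - 1)) *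
          (starRingEnd ℂ) (V.1 r q) ^ 2 ∂μ := ⟨_, rfl⟩
  obtain ⟨M, hM⟩ : ∃ M : ℂ, M = ∫ V : Matrix.unitaryGroup (Fin n) ℂ,
        V.1 p q ^ (k + 1) * (starRingEnd ℂ) (V.1 p q) ^ (k + 1) ∂μ := ⟨_, rfl⟩
  rw [← hP, ← hM]
  have key : ∀ ω : ℂ, ‖ω‖ = 1 → ω * ((k + 1 : ℂ) * P) + (starRingEnd ℂ) ω * Q - ω * M = 0 := by
    intro ω hω
    have hωω : ω * (starRingEnd ℂ) ω = 1 := by rw [Complex.mul_conj', hω]; simp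
    let A : ℝ → Matrix.unitaryGroup (Fin n) ℂ → ℂ := fun x V =>
      Real.cos x * V.1 p q + Real.sin x * ω * V.1 r q
    let B : ℝ → Matrix.unitaryGroup (Fin n) ℂ → ℂ := fun x V =>
      Real.cos x * V.1 r q - Real.sin x * (starRingEnd ℂ) ω * V.1 p q
    let Ac : ℝ → Matrix.unitaryGroup (Fin n) ℂ → ℂ := fun x V => (starRingEnd ℂ) (A x V)
    let Bc : ℝ → Matrix.unitaryGroup (Fin n) ℂ → ℂ := fun x V => (starRingEnd ℂ) (B x V)
    -- The derivative by the product rule; the truncated exponent `k - 1` at `k = 0` is harmless,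
    -- being multiplied by `k`.
    let D : ℝ → Matrix.unitaryGroup (Fin n) ℂ → ℂ := fun x V =>
      (((k + 1 : ℕ) * A x V ^ k * (ω * B x V)) * Ac x V ^ k +
        A x V ^ (k + 1) * (k * Ac x V ^ (k - 1) * ((starRingEnd ℂ) ω * Bc x V))) * Bc x V +
      A x V ^ (k + 1) * Ac x V ^ k * (-(ω * Ac x V))
    have hA : ∀ x V, HasDerivAt (fun x => A x V) (ω * B x V) x := by
      intro x V
      have h1 := ((Real.hasDerivAt_cos x).ofReal_comp.mul_const (V.1 p q)).fun_add
        (((Real.hasDerivAt_sin x).ofReal_comp.mul_const ω).mul_const (V.1 r q))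
      refine HasDerivAt.congr_deriv (f := fun x => A x V) h1 ?_
      dsimp only [B]
      push_cast
      linear_combination (Complex.sin x * V.1 p q) * hωω
    have hB : ∀ x V, HasDerivAt (fun x => B x V) (-((starRingEnd ℂ) ω * A x V)) x := by
      intro x V
      have h1 := ((Real.hasDerivAt_cos x).ofReal_comp.mul_const (V.1 r q)).fun_sub
        (((Real.hasDerivAt_sin x).ofReal_comp.mul_const ((starRingEnd ℂ) ω)).mul_const (V.1 p q))
      refine HasDerivAt.congr_deriv (f := fun x => B x V) h1 ?_
      dsimp only [A]
      push_cast
      linear_combination (Complex.sin x * V.1 r q) * hωω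
    have hAc : ∀ x V, HasDerivAt (fun x => Ac x V) ((starRingEnd ℂ) ω * Bc x V) x := by
      intro x V
      have := (hA x V).star
      simpa [Ac, Bc] using this
    have hBc : ∀ x V, HasDerivAt (fun x => Bc x V) (-(ω * Ac x V)) x := by
      intro x V
      have := (hB x V).star
      simpa [Ac, Bc] using this
    have hD : ∀ x V, HasDerivAt (fun x => A x V ^ (k + 1) * Ac x V ^ k * Bc x V) (D x V) x :=
      fun x V => (((hA x V).fun_pow (k + 1)).fun_mul ((hAc x V).fun_pow k)).fun_mul (hBc x V)
    have cA : ∀ x, Continuous (A x) := fun x =>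
      (continuous_const.mul hp).add (continuous_const.mul hr)
    have cB : ∀ x, Continuous (B x) := fun x =>
      (continuous_const.mul hr).sub (continuous_const.mul hp)
    have cAc : ∀ x, Continuous (Ac x) := fun x => hconj.comp (cA x)
    have cBc : ∀ x, Continuous (Bc x) := fun x => hconj.comp (cB x)
    have cD : ∀ x, Continuous (D x) := fun x =>
      ((((continuous_const.mul ((cA x).pow k)).mul (continuous_const.mul (cB x))).mul
        ((cAc x).pow k)).add (((cA x).pow _).mul ((continuous_const.mul ((cAc x).pow _)).mul
        (continuous_const.mul (cBc x))))).mul (cBc x) |>.add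
        ((((cA x).pow _).mul ((cAc x).pow _)).mul (continuous_const.mul (cAc x)).neg)
    have cg : ∀ x, Continuous fun V => A x V ^ (k + 1) * Ac x V ^ k * Bc x V := fun x =>
      (((cA x).pow _).mul ((cAc x).pow _)).mul (cBc x)
    have bA : ∀ x V, ‖A x V‖ ≤ 2 := by
      intro x V
      refine (norm_add_le _ _).trans ?_
      rw [norm_mul, norm_mul, norm_mul, hω, Complex.norm_real, Complex.norm_real]
      have h1 := unitaryGroup_norm_entry_le_one V p q
      have h2 := unitaryGroup_norm_entry_le_one V r q
      have h3 := Real.abs_cos_le_one x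
      have h4 := Real.abs_sin_le_one x
      simp only [Real.norm_eq_abs]
      nlinarith [norm_nonneg (V.1 p q), norm_nonneg (V.1 r q), abs_nonneg (Real.cos x),
        abs_nonneg (Real.sin x)]
    have bB : ∀ x V, ‖B x V‖ ≤ 2 := by
      intro x V
      refine (norm_sub_le _ _).trans ?_
      rw [norm_mul, norm_mul, norm_mul, Complex.norm_conj, hω, Complex.norm_real,
        Complex.norm_real]
      have h1 := unitaryGroup_norm_entry_le_one V p q
      have h2 := unitaryGroup_norm_entry_le_one V r q
      have h3 := Real.abs_cos_le_one x
      have h4 := Real.abs_sin_le_one x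
      simp only [Real.norm_eq_abs]
      nlinarith [norm_nonneg (V.1 p q), norm_nonneg (V.1 r q), abs_nonneg (Real.cos x),
        abs_nonneg (Real.sin x)]
    have bAc : ∀ x V, ‖Ac x V‖ ≤ 2 := fun x V => by
      simp only [Ac, Complex.norm_conj]; exact bA x V
    have bBc : ∀ x V, ‖Bc x V‖ ≤ 2 := fun x V => by
      simp only [Bc, Complex.norm_conj]; exact bB x V
    have bD : ∀ x V, ‖D x V‖ ≤
        (((k + 1 : ℕ) * 2 ^ k * (1 * 2)) * 2 ^ k + 2 ^ (k + 1) * (k * 2 ^ (k - 1) * (1 * 2))) * 2 +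
          2 ^ (k + 1) * 2 ^ k * (1 * 2) := by
      intro x V
      have hA2 := bA x V; have hB2 := bB x V; have hA3 := bAc x V; have hB3 := bBc x V
      refine (norm_add_le _ _).trans (add_le_add ?_ ?_)
      · rw [norm_mul]
        refine mul_le_mul ((norm_add_le _ _).trans (add_le_add ?_ ?_)) hB3 (norm_nonneg _)
          (by positivity)
        · simp only [norm_mul, norm_pow, Complex.norm_natCast, hω]
          gcongr
        · simp only [norm_mul, norm_pow, Complex.norm_natCast, Complex.norm_conj, hω]
          gcongr
      · simp only [norm_mul, norm_pow, norm_neg, hω]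
        gcongr
    have hder := (hasDerivAt_integral_of_dominated_loc_of_deriv_le (μ := μ) (𝕜 := ℝ)
      (F := fun x V => A x V ^ (k + 1) * Ac x V ^ k * Bc x V) (F' := D) (x₀ := 0)
      (s := Set.univ) Filter.univ_mem
      (Filter.Eventually.of_forall fun x => (cg x).aestronglyMeasurable)
      (integrable_of_continuous_unitaryGroup μ (cg 0)) (cD 0).aestronglyMeasurable
      (Filter.Eventually.of_forall fun V x _ => bD x V) (integrable_const _)
      (Filter.Eventually.of_forall fun V x _ => hD x V)).2
    have hconst : ∀ x, ∫ V, A x V ^ (k + 1) * Ac x V ^ k * Bc x V ∂μ =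
        ∫ V, A 0 V ^ (k + 1) * Ac 0 V ^ k * Bc 0 V ∂μ := by
      have h1 : ∀ x, ∫ V, A x V ^ (k + 1) * Ac x V ^ k * Bc x V ∂μ =
          ∫ V : Matrix.unitaryGroup (Fin n) ℂ, -(V.1 p q ^ (k + 1) *
            (starRingEnd ℂ) (V.1 p q) ^ k * (starRingEnd ℂ) (V.1 r q)) ∂μ := by
        intro x
        rw [← integral_comp_rotate_rows μ hpr q
          (fun u w => -(u ^ (k + 1) * (starRingEnd ℂ) u ^ k * (starRingEnd ℂ) w)) hω x]
        refine integral_congr_ae (Filter.Eventually.of_forall fun V => ?_)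
        change A x V ^ (k + 1) * (starRingEnd ℂ) (A x V) ^ k * Bc x V =
          -((-(A x V)) ^ (k + 1) * (starRingEnd ℂ) (-(A x V)) ^ k * Bc x V)
        rw [map_neg, neg_pow (A x V), neg_pow ((starRingEnd ℂ) (A x V))]
        have : ((-1 : ℂ) ^ k) * (-1) ^ k = 1 := by rw [← mul_pow]; simp
        rw [pow_succ (-1 : ℂ)]
        linear_combination (-(A x V) ^ (k + 1) * (starRingEnd ℂ) (A x V) ^ k * Bc x V) * this
      intro x
      rw [h1 x, h1 0]
    have h0 : ∫ V, D 0 V ∂μ = 0 := by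
      refine hder.unique ?_
      simp_rw [hconst]
      exact hasDerivAt_const _ _
    have hD0 : ∀ V, D 0 V =
        ω * ((k + 1 : ℂ) * (V.1 p q ^ k * (starRingEnd ℂ) (V.1 p q) ^ k *
          (V.1 r q * (starRingEnd ℂ) (V.1 r q)))) +
        (starRingEnd ℂ) ω * (V.1 p q ^ (k + 1) * (k * (starRingEnd ℂ) (V.1 p q) ^ (k - 1)) *
          (starRingEnd ℂ) (V.1 r q) ^ 2) -
        ω * (V.1 p q ^ (k + 1) * (starRingEnd ℂ) (V.1 p q) ^ (k + 1)) := by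
      intro V
      simp only [D, A, B, Ac, Bc, Real.cos_zero, Real.sin_zero, Complex.ofReal_one,
        Complex.ofReal_zero, one_mul, zero_mul, add_zero, sub_zero]
      push_cast
      ring
    have i1 : Integrable (fun V : Matrix.unitaryGroup (Fin n) ℂ => V.1 p q ^ k *
        (starRingEnd ℂ) (V.1 p q) ^ k * (V.1 r q * (starRingEnd ℂ) (V.1 r q))) μ :=
      integrable_of_continuous_unitaryGroup μ
      (((hp.pow k).mul (hpc.pow k)).mul (hr.mul hrc))
    have i2 : Integrable (fun V : Matrix.unitaryGroup (Fin n) ℂ => V.1 p q ^ (k + 1) *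
        (k * (starRingEnd ℂ) (V.1 p q) ^ (k - 1)) * (starRingEnd ℂ) (V.1 r q) ^ 2) μ :=
      integrable_of_continuous_unitaryGroup μ
      (((hp.pow (k + 1)).mul ((continuous_const (y := (k : ℂ))).mul (hpc.pow (k - 1)))).mul
        (hrc.pow 2))
    have i3 : Integrable (fun V : Matrix.unitaryGroup (Fin n) ℂ => V.1 p q ^ (k + 1) *
        (starRingEnd ℂ) (V.1 p q) ^ (k + 1)) μ :=
      integrable_of_continuous_unitaryGroup μ ((hp.pow (k + 1)).mul (hpc.pow (k + 1)))
    rw [hP, hQ, hM, ← h0, ← integral_const_mul, ← integral_const_mul, ← integral_const_mul,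
      ← integral_const_mul, ← integral_add ((i1.const_mul _).const_mul _) (i2.const_mul _),
      ← integral_sub (((i1.const_mul _).const_mul _).fun_add (i2.const_mul _)) (i3.const_mul _)]
    exact integral_congr_ae (Filter.Eventually.of_forall fun V => (hD0 V).symm)
  have h1 := key 1 (by simp)
  have h2 := key Complex.I (by simp)
  rw [Complex.conj_I] at h2
  rw [map_one] at h1
  linear_combination (1 / 2 : ℂ) * h1 - (Complex.I / 2) * h2 +
    (((k + 1 : ℂ) * P - Q - M) / 2) * Complex.I_sq

/-- Inserting `∑ᵢ |V i q|² = 1` into the `k`-th moment gives one term `M` (the next moment) and `n -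
1` terms `M / (k + 1)`, so consecutive moments have ratio `(k + 1) / (k + n)`. -/
theorem integral_entry_pow_mul_conj_pow (μ : Measure (Matrix.unitaryGroup (Fin n) ℂ))
    [μ.IsHaarMeasure] [IsProbabilityMeasure μ] (p q : Fin n) (k : ℕ) :
    ∫ V : Matrix.unitaryGroup (Fin n) ℂ,
      V.1 p q ^ k * (starRingEnd ℂ) (V.1 p q) ^ k ∂μ =
    ∏ j ∈ Finset.range k, ((j + 1 : ℂ) / (j + n)) := by
  induction k with
  | zero => simp
  | succ k ih =>
    have hp := continuous_unitaryGroup_entry p q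
    have hpc := Complex.continuous_conj.comp hp
    have hint : ∀ i, Integrable (fun V : Matrix.unitaryGroup (Fin n) ℂ => V.1 p q ^ k *
        (starRingEnd ℂ) (V.1 p q) ^ k * (V.1 i q * (starRingEnd ℂ) (V.1 i q))) μ := fun i =>
      integrable_of_continuous_unitaryGroup μ (((hp.pow k).mul (hpc.pow k)).mul
        ((continuous_unitaryGroup_entry i q).mul
          (Complex.continuous_conj.comp (continuous_unitaryGroup_entry i q))))
    have hsum : ∫ V : Matrix.unitaryGroup (Fin n) ℂ,
        V.1 p q ^ k * (starRingEnd ℂ) (V.1 p q) ^ k ∂μ =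
        ∑ i, ∫ V : Matrix.unitaryGroup (Fin n) ℂ, V.1 p q ^ k *
        (starRingEnd ℂ) (V.1 p q) ^ k * (V.1 i q * (starRingEnd ℂ) (V.1 i q)) ∂μ := by
      rw [← integral_finsetSum _ fun i _ => hint i]
      refine integral_congr_ae (Filter.Eventually.of_forall fun V => ?_)
      have h1 : ∑ i, V.1 i q * (starRingEnd ℂ) (V.1 i q) = 1 := by
        simp_rw [Complex.mul_conj']
        exact_mod_cast unitaryGroup_sum_normSq_col V q
      simp only [← Finset.mul_sum]
      rw [h1, mul_one]
    have hk : (k + 1 : ℂ) ≠ 0 := Nat.cast_add_one_ne_zero k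
    obtain ⟨M, hM⟩ : ∃ M : ℂ, M = ∫ V : Matrix.unitaryGroup (Fin n) ℂ,
      V.1 p q ^ (k + 1) * (starRingEnd ℂ) (V.1 p q) ^ (k + 1) ∂μ := ⟨_, rfl⟩
    have hpp : ∫ V : Matrix.unitaryGroup (Fin n) ℂ, V.1 p q ^ k *
        (starRingEnd ℂ) (V.1 p q) ^ k * (V.1 p q * (starRingEnd ℂ) (V.1 p q)) ∂μ = M := by
      rw [hM]
      refine integral_congr_ae (Filter.Eventually.of_forall fun V => ?_)
      simp only
      ring
    have hoff : ∀ i ∈ Finset.univ.erase p, ∫ V : Matrix.unitaryGroup (Fin n) ℂ, V.1 p q ^ k *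
        (starRingEnd ℂ) (V.1 p q) ^ k * (V.1 i q * (starRingEnd ℂ) (V.1 i q)) ∂μ =
        M / (k + 1) := by
      intro i hi
      rw [eq_div_iff hk, mul_comm, hM]
      exact integral_normSq_pow_mul_normSq μ (Finset.ne_of_mem_erase hi).symm q k
    have hn1 : 1 ≤ n := by have := p.2; omega
    rw [← Finset.add_sum_erase _ _ (Finset.mem_univ p), hpp, Finset.sum_congr rfl hoff,
      Finset.sum_const, Finset.card_erase_of_mem (Finset.mem_univ p), Finset.card_univ,
      Fintype.card_fin, nsmul_eq_mul, Nat.cast_sub hn1, ih] at hsum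
    have hkn : (k + n : ℂ) ≠ 0 := by
      rw [← Nat.cast_add]; exact Nat.cast_ne_zero.2 (by omega)
    rw [← hM, Finset.prod_range_succ, hsum]
    push_cast
    field_simp
    ring

end EntryMoments

/-! ### The integral of a single factor -/

section EntryIntegral

open Filter Topology

/-- The Taylor coefficients of `(1 - z) ^ a` at `0`. -/
noncomputable def oneSubCpowCoeff (a : ℂ) (k : ℕ) : ℂ :=
  ∏ j ∈ Finset.range k, (((j : ℂ) - a) / (j + 1))

theorem choose_mul_neg_one_pow (a : ℂ) (k : ℕ) :
    Ring.choose a k * (-1) ^ k = oneSubCpowCoeff a k := by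
  have h : ∀ k : ℕ, (descPochhammer ℤ (k + 1)).smeval a =
      (descPochhammer ℤ k).smeval a * (a - k) := by
    intro k
    rw [descPochhammer_succ_right, Polynomial.smeval_mul, Polynomial.smeval_sub,
      Polynomial.smeval_X, Polynomial.smeval_natCast]
    simp
  have h2 : ∀ k : ℕ, (descPochhammer ℤ k).smeval a = (k.factorial : ℂ) * Ring.choose a k := by
    intro k
    rw [Ring.descPochhammer_eq_factorial_smul_choose, nsmul_eq_mul]
  induction k with
  | zero => simp [oneSubCpowCoeff]
  | succ k ih =>
    have h3 := h k
    rw [h2, h2, Nat.factorial_succ] at h3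
    have hf : (k.factorial : ℂ) ≠ 0 := Nat.cast_ne_zero.2 k.factorial_ne_zero
    have hk : (k + 1 : ℂ) ≠ 0 := Nat.cast_add_one_ne_zero k
    have h4 : (k + 1 : ℂ) * Ring.choose a (k + 1) = Ring.choose a k * (a - k) := by
      refine mul_left_cancel₀ hf ?_
      push_cast at h3
      linear_combination h3
    rw [oneSubCpowCoeff, Finset.prod_range_succ, ← oneSubCpowCoeff, ← ih, pow_succ]
    field_simp
    linear_combination -h4

theorem hasSum_oneSubCpowCoeff (a : ℂ) {z : ℂ} (hz : ‖z‖ < 1) :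
    HasSum (fun k => oneSubCpowCoeff a k * z ^ k) (Complex.exp (a * Complex.log (1 - z))) := by
  have hmem : -z ∈ Metric.eball (0 : ℂ) 1 := by
    rw [← ENNReal.ofReal_one, Metric.eball_ofReal]
    simpa using hz
  have h := (Complex.one_add_cpow_hasFPowerSeriesOnBall_zero (a := a)).hasSum hmem
  have hne : 1 - z ≠ 0 := by
    intro h0
    rw [← sub_eq_zero.1 h0] at hz
    simp at hz
  rw [zero_add, ← sub_eq_add_neg, Complex.cpow_def_of_ne_zero hne, mul_comm _ a] at h
  have e : (fun k => oneSubCpowCoeff a k * z ^ k) =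
      fun k => binomialSeries ℂ a k fun _ => -z := by
    funext k
    rw [binomialSeries_apply, List.ofFn_const, List.prod_replicate, smul_eq_mul, neg_pow,
      ← choose_mul_neg_one_pow]
    ring
  rw [e]
  exact h

theorem expPair_log_one_sub_eq (a b : ℂ) {z : ℂ} (hz : ‖z‖ < 1) :
    expPair a b (Complex.log (1 - z)) = Complex.exp (a * Complex.log (1 - z)) *
      Complex.exp (b * Complex.log (1 - (starRingEnd ℂ) z)) := by
  have h1 : z ≠ 1 := by rintro rfl; simp at hz
  have hpos := one_sub_re_pos hz.le h1
  have harg : (1 - z).arg ≠ Real.pi := by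
    intro h
    have := Complex.arg_eq_pi_iff.1 h
    linarith [this.1]
  rw [expPair, Complex.exp_add, ← Complex.log_conj _ harg]
  simp

theorem hasSum_mul_prod {f g : ℕ → ℂ} {s t : ℂ} (hf : HasSum f s) (hg : HasSum g t) :
    HasSum (fun x : ℕ × ℕ => f x.1 * g x.2) (s * t) :=
  hf.mul hg (summable_mul_of_summable_norm hf.summable.norm hg.summable.norm)

theorem hasSum_expPair_log_one_sub (a b : ℂ) {z : ℂ} (hz : ‖z‖ < 1) :
    HasSum (fun x : ℕ × ℕ => (oneSubCpowCoeff a x.1 * z ^ x.1) *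
      (oneSubCpowCoeff b x.2 * (starRingEnd ℂ) z ^ x.2))
      (expPair a b (Complex.log (1 - z))) := by
  have h1 := hasSum_oneSubCpowCoeff a hz
  have h2 := hasSum_oneSubCpowCoeff b (z := (starRingEnd ℂ) z) (by simpa using hz)
  have h3 := hasSum_mul_prod h1 h2
  rw [← expPair_log_one_sub_eq a b hz] at h3
  exact h3

variable {n : ℕ}

/-- For `r < 1` the double binomial series converges absolutely and uniformly in `V`, so it
integrates term by term; only the diagonal survives, with the entry moments as weights. -/
theorem hasSum_integral_expPair_log_one_sub_smul
    (μ : Measure (Matrix.unitaryGroup (Fin n) ℂ)) [μ.IsHaarMeasure] [IsProbabilityMeasure μ]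
    (p q : Fin n) (a b : ℂ) {r : ℝ} (hr0 : 0 ≤ r) (hr1 : r < 1) :
    HasSum (fun k => gaussTerm a b n k * (r : ℂ) ^ (2 * k))
      (∫ V : Matrix.unitaryGroup (Fin n) ℂ,
        expPair a b (Complex.log (1 - r * V.1 p q)) ∂μ) := by
  have hp := continuous_unitaryGroup_entry p q
  have hpc := Complex.continuous_conj.comp hp
  have hnr : ‖(r : ℂ)‖ = r := by rw [Complex.norm_real, Real.norm_of_nonneg hr0]
  have hlt : ∀ V : Matrix.unitaryGroup (Fin n) ℂ, ‖(r : ℂ) * V.1 p q‖ < 1 := by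
    intro V
    rw [norm_mul, hnr]
    have := unitaryGroup_norm_entry_le_one V p q
    nlinarith [norm_nonneg (V.1 p q)]
  let F : ℕ × ℕ → Matrix.unitaryGroup (Fin n) ℂ → ℂ := fun x V =>
    (oneSubCpowCoeff a x.1 * (r * V.1 p q) ^ x.1) *
      (oneSubCpowCoeff b x.2 * (starRingEnd ℂ) (r * V.1 p q) ^ x.2)
  have hFc : ∀ x, Continuous (F x) := fun x =>
    (continuous_const.mul ((continuous_const.mul hp).pow _)).mul
      (continuous_const.mul ((Complex.continuous_conj.comp (continuous_const.mul hp)).pow _))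
  have hFi : ∀ x, Integrable (F x) μ := fun x => integrable_of_continuous_unitaryGroup μ (hFc x)
  have hFb : ∀ x V, ‖F x V‖ ≤ ‖oneSubCpowCoeff a x.1 * (r : ℂ) ^ x.1‖ *
      ‖oneSubCpowCoeff b x.2 * (r : ℂ) ^ x.2‖ := by
    intro x V
    have h1 := unitaryGroup_norm_entry_le_one V p q
    have h2 : ‖(r : ℂ) * V.1 p q‖ ≤ ‖(r : ℂ)‖ := by
      rw [norm_mul]; exact mul_le_of_le_one_right (norm_nonneg _) h1
    simp only [F, norm_mul (oneSubCpowCoeff _ _ * _), norm_mul (oneSubCpowCoeff _ _), norm_pow,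
      Complex.norm_conj]
    gcongr
  have hsr : Summable fun x : ℕ × ℕ => ‖oneSubCpowCoeff a x.1 * (r : ℂ) ^ x.1‖ *
      ‖oneSubCpowCoeff b x.2 * (r : ℂ) ^ x.2‖ := by
    have h1 := (hasSum_oneSubCpowCoeff a (z := r) (by rwa [hnr])).summable.norm
    have h2 := (hasSum_oneSubCpowCoeff b (z := r) (by rwa [hnr])).summable.norm
    exact h1.mul_of_nonneg h2 (fun _ => norm_nonneg _) fun _ => norm_nonneg _
  have hsum := hasSum_integral_of_summable_integral_norm (F := F) hFi (by
    refine Summable.of_nonneg_of_le (fun x => integral_nonneg fun V => norm_nonneg _)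
      (fun x => ?_) hsr
    calc ∫ V, ‖F x V‖ ∂μ ≤ ∫ _, ‖oneSubCpowCoeff a x.1 * (r : ℂ) ^ x.1‖ *
          ‖oneSubCpowCoeff b x.2 * (r : ℂ) ^ x.2‖ ∂μ :=
          integral_mono (hFi x).norm (integrable_const _) fun V => hFb x V
      _ = _ := by simp)
  have htsum : ∀ V, ∑' x, F x V = expPair a b (Complex.log (1 - r * V.1 p q)) := fun V =>
    (hasSum_expPair_log_one_sub a b (hlt V)).tsum_eq
  simp_rw [htsum] at hsum
  have hval : ∀ x : ℕ × ℕ, ∫ V, F x V ∂μ = (oneSubCpowCoeff a x.1 * oneSubCpowCoeff b x.2 *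
      (r : ℂ) ^ (x.1 + x.2)) * ∫ V : Matrix.unitaryGroup (Fin n) ℂ,
        V.1 p q ^ x.1 * (starRingEnd ℂ) (V.1 p q) ^ x.2 ∂μ := by
    intro x
    rw [← integral_const_mul]
    refine integral_congr_ae (Eventually.of_forall fun V => ?_)
    simp only [F, map_mul, Complex.conj_ofReal]
    ring
  have hinj : Function.Injective fun k : ℕ => (k, k) := fun k l h => (Prod.ext_iff.1 h).1
  rw [← hinj.hasSum_iff] at hsum
  · have e : (fun k => gaussTerm a b n k * (r : ℂ) ^ (2 * k)) =
        (fun x => ∫ V, F x V ∂μ) ∘ fun k => (k, k) := by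
      funext k
      simp only [Function.comp_apply, hval, integral_entry_pow_mul_conj_pow]
      rw [oneSubCpowCoeff, oneSubCpowCoeff, mul_right_comm, ← Finset.prod_mul_distrib,
        ← Finset.prod_mul_distrib, gaussTerm, ← two_mul]
      congr 1
      refine Finset.prod_congr rfl fun j _ => ?_
      have : (j + 1 : ℂ) ≠ 0 := Nat.cast_add_one_ne_zero j
      field_simp
    rw [e]
    exact hsum
  · intro x hx
    have hne : x.1 ≠ x.2 := fun h => hx ⟨x.1, Prod.ext rfl h⟩
    rw [hval, integral_entry_pow_mul_conj_pow_eq_zero μ p q hne, mul_zero]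

theorem norm_expPair (a b w : ℂ) :
    ‖expPair a b w‖ = Real.exp ((a + b).re * w.re - (a.im - b.im) * w.im) := by
  rw [expPair, Complex.norm_exp]
  congr 1
  simp only [Complex.add_re, Complex.mul_re, Complex.conj_re, Complex.conj_im]
  ring

theorem norm_expPair_log_le (a b z : ℂ) :
    ‖expPair a b (Complex.log z)‖ ≤
      Real.exp (Real.pi * |a.im - b.im|) * Real.exp ((a + b).re * Real.log ‖z‖) := by
  rw [norm_expPair, Complex.log_re, ← Real.exp_add, Real.exp_le_exp]
  have h1 : |(Complex.log z).im| ≤ Real.pi := by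
    rw [Complex.log_im]; exact Complex.abs_arg_le_pi z
  have h2 := neg_abs_le ((a.im - b.im) * (Complex.log z).im)
  rw [abs_mul] at h2
  have h3 := mul_le_mul_of_nonneg_left h1 (abs_nonneg (a.im - b.im))
  linarith

/-- A bound uniform in `r`, for dominated convergence. Since `|1 - z| ≤ |1 - rz| + (1 - r)` and `1 -
r ≤ |1 - rz|`, one has `|1 - z| ≤ 2|1 - rz|`, which serves for `τ < 0`; for `τ ≥ 0`, `|1 - rz| ≤ 2`
is enough. -/
theorem exp_mul_log_norm_le (z : ℂ) (hz : ‖z‖ ≤ 1) (h1 : z ≠ 1) {r : ℝ} (hr0 : 0 ≤ r) (hr1 : r ≤ 1)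
    (τ : ℝ) : Real.exp (τ * Real.log ‖1 - r * z‖) ≤
      Real.exp (|τ| * Real.log 2) * (1 + Real.exp (τ * Real.log ‖1 - z‖)) := by
  have hpos : 0 < ‖1 - z‖ := norm_pos_iff.2 (sub_ne_zero.2 h1.symm)
  have hnr : ‖(r : ℂ)‖ = r := by rw [Complex.norm_real, Real.norm_of_nonneg hr0]
  have hrz : ‖(r : ℂ) * z‖ ≤ r := by
    rw [norm_mul, hnr]; exact mul_le_of_le_one_right hr0 hz
  have hlow : ‖1 - z‖ ≤ 2 * ‖1 - r * z‖ := by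
    have e : 1 - z = (1 - r * z) - ((1 - r : ℝ) : ℂ) * z := by push_cast; ring
    have h2 : ‖1 - z‖ ≤ ‖1 - r * z‖ + ‖((1 - r : ℝ) : ℂ) * z‖ := by
      rw [e]; exact norm_sub_le _ _
    have h3 : ‖((1 - r : ℝ) : ℂ) * z‖ ≤ 1 - r := by
      rw [norm_mul, Complex.norm_real, Real.norm_of_nonneg (by linarith)]
      exact mul_le_of_le_one_right (by linarith) hz
    have h4 : 1 - r ≤ ‖1 - r * z‖ := by
      have := norm_sub_norm_le (1 : ℂ) (r * z)
      rw [norm_one] at this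
      linarith
    linarith
  have hpos' : 0 < ‖1 - r * z‖ := by linarith
  have hup : ‖1 - r * z‖ ≤ 2 := by
    refine (norm_sub_le _ _).trans ?_
    rw [norm_one]
    linarith
  have hl1 : Real.log ‖1 - r * z‖ ≤ Real.log 2 := Real.log_le_log hpos' hup
  have hl2 : Real.log ‖1 - z‖ ≤ Real.log 2 + Real.log ‖1 - r * z‖ := by
    rw [← Real.log_mul two_ne_zero hpos'.ne']
    exact Real.log_le_log hpos hlow
  rcases le_or_gt 0 τ with h | h
  · rw [abs_of_nonneg h]
    have : Real.exp (τ * Real.log ‖1 - r * z‖) ≤ Real.exp (τ * Real.log 2) :=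
      Real.exp_le_exp.2 (mul_le_mul_of_nonneg_left hl1 h)
    nlinarith [Real.exp_pos (τ * Real.log 2), Real.exp_pos (τ * Real.log ‖1 - z‖)]
  · rw [abs_of_neg h]
    have : Real.exp (τ * Real.log ‖1 - r * z‖) ≤
        Real.exp (-τ * Real.log 2) * Real.exp (τ * Real.log ‖1 - z‖) := by
      rw [← Real.exp_add, Real.exp_le_exp]
      nlinarith
    nlinarith [Real.exp_pos (-τ * Real.log 2)]

theorem tendsto_one_sub_inv_add_two :
    Tendsto (fun m : ℕ => (1 - 1 / ((m : ℝ) + 2))) atTop (𝓝 1) := by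
  have h := tendsto_one_div_add_atTop_nhds_zero_nat (𝕜 := ℝ)
  have h2 : Tendsto (fun m : ℕ => 1 / ((m : ℝ) + 2)) atTop (𝓝 0) := by
    refine (h.comp (tendsto_add_atTop_nat 1)).congr fun m => ?_
    simp only [Function.comp_apply]
    push_cast
    ring_nf
  simpa using h2.const_sub 1

theorem continuous_expPair_log_one_sub_smul_entry (p q : Fin n) (a b : ℂ) {r : ℝ} (hr0 : 0 ≤ r)
    (hr1 : r < 1) : Continuous fun V : Matrix.unitaryGroup (Fin n) ℂ =>
      expPair a b (Complex.log (1 - r * V.1 p q)) := by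
  refine (continuous_expPair a b).comp (Continuous.clog
    (continuous_const.sub (continuous_const.mul (continuous_unitaryGroup_entry p q))) fun V => ?_)
  have hlt : ‖(r : ℂ) * V.1 p q‖ < 1 := by
    rw [norm_mul, Complex.norm_real, Real.norm_of_nonneg hr0]
    have := unitaryGroup_norm_entry_le_one V p q
    nlinarith [norm_nonneg (V.1 p q)]
  exact Or.inl (one_sub_re_pos hlt.le (by rintro h; rw [h] at hlt; simp at hlt))

theorem tendsto_expPair_log_one_sub_smul (a b : ℂ) {z : ℂ} (hz : ‖z‖ ≤ 1) (h1 : z ≠ 1) :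
    Tendsto (fun m : ℕ => expPair a b (Complex.log (1 - ((1 - 1 / ((m : ℝ) + 2) : ℝ) : ℂ) * z)))
      atTop (𝓝 (expPair a b (Complex.log (1 - z)))) := by
  refine ((continuous_expPair a b).tendsto _).comp (Tendsto.clog ?_ (Or.inl (one_sub_re_pos hz h1)))
  have h := (Complex.continuous_ofReal.tendsto 1).comp tendsto_one_sub_inv_add_two
  simpa using (h.mul_const z).const_sub 1

theorem one_sub_inv_add_two_mem (m : ℕ) :
    0 ≤ 1 - 1 / ((m : ℝ) + 2) ∧ 1 - 1 / ((m : ℝ) + 2) < 1 := by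
  constructor
  · rw [sub_nonneg, div_le_one (by positivity)]
    linarith [(Nat.cast_nonneg m : (0 : ℝ) ≤ m)]
  · have : 0 < 1 / ((m : ℝ) + 2) := by positivity
    linarith

/-- For equal real exponents the integrand is nonnegative, so its `L¹` norm at `r < 1` is its
integral, bounded by `∑ ‖gaussTerm‖` independently of `r`; Fatou's lemma passes to `r = 1`. This
supplies the dominating function for complex exponents. -/
theorem integrable_expPair_log_one_sub_entry_of_real
    (μ : Measure (Matrix.unitaryGroup (Fin n) ℂ)) [μ.IsHaarMeasure] [IsProbabilityMeasure μ]
    (p q : Fin n) {α : ℝ} (hα : -1 < 2 * α) :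
    Integrable (fun V : Matrix.unitaryGroup (Fin n) ℂ =>
      expPair α α (Complex.log (1 - V.1 p q))) μ := by
  have hn : 1 ≤ n := by have := p.2; omega
  set f : ℕ → Matrix.unitaryGroup (Fin n) ℂ → ℂ := fun m V =>
    expPair α α (Complex.log (1 - ((1 - 1 / ((m : ℝ) + 2) : ℝ) : ℂ) * V.1 p q)) with hf
  have hlim : ∀ᵐ V : Matrix.unitaryGroup (Fin n) ℂ ∂μ, Tendsto (fun m => f m V) atTop
      (𝓝 (expPair α α (Complex.log (1 - V.1 p q)))) := by
    filter_upwards [ae_entry_ne_one μ p q] with V hV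
    exact tendsto_expPair_log_one_sub_smul _ _ (unitaryGroup_norm_entry_le_one V p q) hV
  have hcont : ∀ m, Continuous (f m) := fun m =>
    continuous_expPair_log_one_sub_smul_entry p q _ _ (one_sub_inv_add_two_mem m).1
      (one_sub_inv_add_two_mem m).2
  have hint : ∀ m, Integrable (f m) μ := fun m => integrable_of_continuous_unitaryGroup μ (hcont m)
  have hreal : ∀ w, expPair α α w = ((‖expPair α α w‖ : ℝ) : ℂ) := by
    intro w
    rw [norm_expPair, expPair, Complex.ofReal_exp]
    congr 1
    apply Complex.ext <;> simp
    ring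
  have hs := (summable_gaussTerm_and_tendsto (a := α) (b := α) hn (by
    rw [Complex.add_re, Complex.ofReal_re]; linarith)).1
  set C := ∑' k, ‖gaussTerm α α n k‖ with hC
  have hbound : ∀ m, ∫ V, ‖f m V‖ ∂μ ≤ C := by
    intro m
    have h1 : ((∫ V, ‖f m V‖ ∂μ : ℝ) : ℂ) = ∫ V, f m V ∂μ := by
      rw [← integral_complex_ofReal]
      exact integral_congr_ae (Eventually.of_forall fun V => (hreal _).symm)
    obtain ⟨hr0, hr1⟩ := one_sub_inv_add_two_mem m
    have h2 := hasSum_integral_expPair_log_one_sub_smul μ p q α α hr0 hr1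
    have h3 : ‖∫ V, f m V ∂μ‖ ≤ C := by
      rw [hf]
      simp only
      rw [← h2.tsum_eq]
      refine tsum_of_norm_bounded hs.hasSum fun k => ?_
      rw [norm_mul, norm_pow, Complex.norm_real, Real.norm_of_nonneg hr0]
      exact mul_le_of_le_one_right (norm_nonneg _) (pow_le_one₀ hr0 hr1.le)
    rw [← h1, Complex.norm_real] at h3
    exact (le_abs_self _).trans h3
  refine ⟨aestronglyMeasurable_of_tendsto_ae atTop (fun m => (hcont m).aestronglyMeasurable) hlim,
    ?_⟩
  have hlint : ∀ m, ∫⁻ V, ‖f m V‖ₑ ∂μ ≤ ENNReal.ofReal C := by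
    intro m
    rw [← ofReal_integral_norm_eq_lintegral_enorm (hint m)]
    exact ENNReal.ofReal_le_ofReal (hbound m)
  calc ∫⁻ V : Matrix.unitaryGroup (Fin n) ℂ, ‖expPair α α (Complex.log (1 - V.1 p q))‖ₑ ∂μ
      = ∫⁻ V, liminf (fun m => ‖f m V‖ₑ) atTop ∂μ := by
        refine lintegral_congr_ae ?_
        filter_upwards [hlim] with V hV
        exact hV.enorm.liminf_eq.symm
    _ ≤ liminf (fun m => ∫⁻ V, ‖f m V‖ₑ ∂μ) atTop :=
        lintegral_liminf_le fun m => (hcont m).enorm.measurable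
    _ ≤ liminf (fun _ : ℕ => ENNReal.ofReal C) atTop :=
        liminf_le_liminf (Eventually.of_forall hlint)
    _ < ⊤ := by simp

theorem integral_expPair_log_one_sub_entry
    (μ : Measure (Matrix.unitaryGroup (Fin n) ℂ)) [μ.IsHaarMeasure] [IsProbabilityMeasure μ]
    (p q : Fin n) {a b : ℂ} (ha : -1 / 2 < a.re) (hb : -1 / 2 < b.re) :
    Integrable (fun V : Matrix.unitaryGroup (Fin n) ℂ =>
      expPair a b (Complex.log (1 - V.1 p q))) μ ∧
    ∫ V : Matrix.unitaryGroup (Fin n) ℂ, expPair a b (Complex.log (1 - V.1 p q)) ∂μ =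
      Complex.Gamma n * Complex.Gamma (n + a + b) /
      (Complex.Gamma (n + a) * Complex.Gamma (n + b)) := by
  have hn : 1 ≤ n := by have := p.2; omega
  have hab : -1 < (a + b).re := by rw [Complex.add_re]; linarith
  set f : ℕ → Matrix.unitaryGroup (Fin n) ℂ → ℂ := fun m V =>
    expPair a b (Complex.log (1 - ((1 - 1 / ((m : ℝ) + 2) : ℝ) : ℂ) * V.1 p q)) with hf
  have hlim : ∀ᵐ V : Matrix.unitaryGroup (Fin n) ℂ ∂μ, Tendsto (fun m => f m V) atTop
      (𝓝 (expPair a b (Complex.log (1 - V.1 p q)))) := by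
    filter_upwards [ae_entry_ne_one μ p q] with V hV
    exact tendsto_expPair_log_one_sub_smul _ _ (unitaryGroup_norm_entry_le_one V p q) hV
  have hcont : ∀ m, Continuous (f m) := fun m =>
    continuous_expPair_log_one_sub_smul_entry p q _ _ (one_sub_inv_add_two_mem m).1
      (one_sub_inv_add_two_mem m).2
  -- With this `α`, the modulus of `expPair a b` at a principal logarithm is at most `K = exp (π |Im
  -- a - Im b|)` times that of `expPair α α`.
  set α : ℝ := (a + b).re / 2 with hα
  have hreal := (integrable_expPair_log_one_sub_entry_of_real μ p q (α := α)
    (by rw [hα]; linarith)).norm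
  have hnorm : ∀ z : ℂ, ‖expPair α α (Complex.log z)‖ = Real.exp ((a + b).re * Real.log ‖z‖) := by
    intro z
    rw [norm_expPair, Complex.log_re]
    congr 1
    simp [hα]
  simp_rw [hnorm] at hreal
  set K := Real.exp (Real.pi * |a.im - b.im|) with hK
  have hdom : Integrable (fun V : Matrix.unitaryGroup (Fin n) ℂ => K *
      (Real.exp (|(a + b).re| * Real.log 2) *
        (1 + Real.exp ((a + b).re * Real.log ‖1 - V.1 p q‖)))) μ :=
    (((integrable_const 1).add hreal).const_mul _).const_mul _
  have hbound : ∀ m, ∀ᵐ V : Matrix.unitaryGroup (Fin n) ℂ ∂μ, ‖f m V‖ ≤ K *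
      (Real.exp (|(a + b).re| * Real.log 2) *
        (1 + Real.exp ((a + b).re * Real.log ‖1 - V.1 p q‖))) := by
    intro m
    filter_upwards [ae_entry_ne_one μ p q] with V hV
    refine (norm_expPair_log_le a b _).trans (mul_le_mul_of_nonneg_left ?_ (Real.exp_nonneg _))
    exact exp_mul_log_norm_le _ (unitaryGroup_norm_entry_le_one V p q) hV
      (one_sub_inv_add_two_mem m).1 (one_sub_inv_add_two_mem m).2.le _
  have hconv := tendsto_integral_of_dominated_convergence _
    (fun m => (hcont m).aestronglyMeasurable) hdom hbound hlim
  constructor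
  · refine hdom.mono' (aestronglyMeasurable_of_tendsto_ae atTop
      (fun m => (hcont m).aestronglyMeasurable) hlim) ?_
    filter_upwards [ae_entry_ne_one μ p q] with V hV
    refine (norm_expPair_log_le a b _).trans (mul_le_mul_of_nonneg_left ?_ (Real.exp_nonneg _))
    simpa using exp_mul_log_norm_le _ (unitaryGroup_norm_entry_le_one V p q) hV
      zero_le_one le_rfl (a + b).re
  · rw [← tsum_gaussTerm hn ha hb]
    refine tendsto_nhds_unique hconv ?_
    have hval : ∀ m, ∫ V, f m V ∂μ = ∑' k, gaussTerm a b n k *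
        ((1 - 1 / ((m : ℝ) + 2) : ℝ) : ℂ) ^ (2 * k) := fun m =>
      (hasSum_integral_expPair_log_one_sub_smul μ p q a b (one_sub_inv_add_two_mem m).1
        (one_sub_inv_add_two_mem m).2).tsum_eq.symm
    simp_rw [hval]
    -- The series side passes to `r = 1` as well, absolute summability at `1` being the domination.
    refine tendsto_tsum_of_dominated_convergence (summable_gaussTerm_and_tendsto hn hab).1
      (fun k => ?_) (Eventually.of_forall fun m k => ?_)
    · have h := (Complex.continuous_ofReal.tendsto 1).comp tendsto_one_sub_inv_add_two
      simpa using (h.pow (2 * k)).const_mul (gaussTerm a b n k)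
    · obtain ⟨hr0, hr1⟩ := one_sub_inv_add_two_mem m
      rw [norm_mul, norm_pow, Complex.norm_real, Real.norm_of_nonneg hr0]
      exact mul_le_of_le_one_right (norm_nonneg _) (pow_le_one₀ hr0 hr1.le)

end EntryIntegral

/-! ### Induction on the dimension and reduction to angle zero -/

section Main

theorem charpoly_smul_roots {n : ℕ} (A : Matrix (Fin n) (Fin n) ℂ) {c : ℂ} (hc : c ≠ 0) :
    (c • A).charpoly.roots = A.charpoly.roots.map fun z => c * z := by
  have hs : A.charpoly.Splits := IsAlgClosed.splits _
  have hcard : A.charpoly.roots.card = n := by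
    rw [← hs.natDegree_eq_card_roots, Matrix.charpoly_natDegree_eq_dim, Fintype.card_fin]
  have key : (c • A).charpoly =
      ((A.charpoly.roots.map fun z => c * z).map fun z => Polynomial.X - Polynomial.C z).prod := by
    refine Polynomial.funext fun x => ?_
    have h1 : Matrix.scalar (Fin n) x - c • A = c • (Matrix.scalar (Fin n) (c⁻¹ * x) - A) := by
      ext i j
      simp only [Matrix.scalar_apply, Matrix.sub_apply, Matrix.smul_apply, Matrix.diagonal_apply,
        smul_eq_mul]
      split_ifs
      · field_simp
      · ring
    have h2 : A.charpoly.eval (c⁻¹ * x) = (A.charpoly.roots.map fun z => c⁻¹ * x - z).prod := by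
      conv_lhs => rw [hs.eq_prod_roots_of_monic A.charpoly_monic]
      rw [Polynomial.eval_multiset_prod, Multiset.map_map]
      simp
    have h3 : c ^ n = c ^ A.charpoly.roots.card := by rw [hcard]
    rw [Matrix.eval_charpoly, h1, Matrix.det_smul, ← Matrix.eval_charpoly, h2, Fintype.card_fin,
      h3, Polynomial.eval_multiset_prod, Multiset.map_map, Multiset.map_map,
      ← Multiset.prod_replicate, ← Multiset.map_const', ← Multiset.prod_map_mul]
    congr 1
    refine Multiset.map_congr rfl fun z _ => ?_
    simp only [Function.comp_apply, Polynomial.eval_sub, Polynomial.eval_X, Polynomial.eval_C]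
    rw [mul_sub, mul_inv_cancel_left₀ hc]
  rw [key, Polynomial.roots_multiset_prod_X_sub_C]

theorem integral_expPair_logDetOneSub {a b : ℂ} (ha : -1 / 2 < a.re) (hb : -1 / 2 < b.re) (N : ℕ)
    (μ : Measure (Matrix.unitaryGroup (Fin N) ℂ)) [μ.IsHaarMeasure] [IsProbabilityMeasure μ] :
    Integrable (fun V : Matrix.unitaryGroup (Fin N) ℂ => expPair a b (logDetOneSub V.1)) μ ∧
    ∫ V : Matrix.unitaryGroup (Fin N) ℂ, expPair a b (logDetOneSub V.1) ∂μ =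
      ∏ k ∈ Finset.Icc 1 N, Complex.Gamma k * Complex.Gamma (k + a + b) /
        (Complex.Gamma (k + a) * Complex.Gamma (k + b)) := by
  induction N with
  | zero =>
    have h : ∀ V : Matrix.unitaryGroup (Fin 0) ℂ, expPair a b (logDetOneSub V.1) = 1 := by
      intro V
      rw [Subsingleton.elim V.1 0, logDetOneSub_zero]
      simp [expPair]
    simp_rw [h]
    exact ⟨integrable_const _, by simp⟩
  | succ n ih =>
    obtain ⟨ν, hν, hν1⟩ := exists_haar_probability_measure n
    obtain ⟨hF, hFv⟩ := ih ν
    obtain ⟨hG, hGv⟩ := integral_expPair_log_one_sub_entry μ 0 0 ha hb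
    obtain ⟨h1, h2⟩ := integral_expPair_logDetOneSub_succ a b μ ν hG hF
    refine ⟨h1, ?_⟩
    rw [h2, hFv, hGv, Finset.prod_Icc_succ_top (Nat.le_add_left 1 n), mul_comm]

theorem exp_neg_I_mul_eq_circleExp (θ : ℝ) :
    Complex.exp (-(Complex.I * θ)) = (Circle.exp (-θ) : ℂ) := by
  rw [Circle.coe_exp]
  congr 1
  push_cast
  ring

theorem charPolyCircle_eq_det {N : ℕ} (V : Matrix.unitaryGroup (Fin N) ℂ) (θ : ℝ) :
    charPolyCircle V θ = (1 - (unitaryScalar N (Circle.exp (-θ)) * V).1).det := by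
  rw [charPolyCircle, exp_neg_I_mul_eq_circleExp, unitaryScalar_mul_coe]

theorem logCharPolyCircle_eq_logDetOneSub {N : ℕ} (V : Matrix.unitaryGroup (Fin N) ℂ) (θ : ℝ) :
    logCharPolyCircle V θ = logDetOneSub (unitaryScalar N (Circle.exp (-θ)) * V).1 := by
  rw [logDetOneSub, unitaryScalar_mul_coe, charpoly_smul_roots _ (Circle.coe_ne_zero _),
    Multiset.map_map, logCharPolyCircle, exp_neg_I_mul_eq_circleExp]
  rfl

/-- The exponents solve `a w + b w̄ = t Re w + i s Im w`, that is `a + b = t` and `a - b = s`. Any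
logarithm `w` is allowed, so the unreduced argument is covered. -/
theorem norm_cpow_mul_exp_arg_eq_expPair {Z w t s : ℂ} (hZ : Z ≠ 0) (hw : Complex.exp w = Z) :
    ((‖Z‖ : ℝ) : ℂ) ^ t * Complex.exp (Complex.I * s * (w.im : ℂ)) =
      expPair ((t + s) / 2) ((t - s) / 2) w := by
  have hn : ((‖Z‖ : ℝ) : ℂ) ≠ 0 := Complex.ofReal_ne_zero.2 (norm_ne_zero_iff.2 hZ)
  have hlog : Complex.log ((‖Z‖ : ℝ) : ℂ) = (w.re : ℂ) := by
    rw [← Complex.ofReal_log (norm_nonneg _), ← hw, Complex.norm_exp, Real.log_exp]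
  rw [Complex.cpow_def_of_ne_zero hn, hlog, ← Complex.exp_add, expPair]
  congr 1
  have h1 : (starRingEnd ℂ) w = w.re - w.im * Complex.I := by
    apply Complex.ext <;> simp
  rw [h1]
  conv_rhs => rw [← Complex.re_add_im w]
  simp only [Complex.add_re, Complex.ofReal_re, Complex.mul_re, Complex.I_re, mul_zero,
    Complex.ofReal_im, Complex.I_im, mul_one, sub_self, add_zero, Complex.add_im, Complex.mul_im,
    zero_add]
  ring

end Main

theorem mainTheorem5 (N : ℕ) (μ : Measure (Matrix.unitaryGroup (Fin N) ℂ))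
    [μ.IsHaarMeasure] [IsProbabilityMeasure μ] (θ : ℝ) (t s : ℂ)
    (h_add : -1 < (t + s).re) (h_sub : -1 < (t - s).re) :
    (∀ᵐ V ∂μ, charPolyCircle V θ ≠ 0) ∧
    Integrable (fun V => ((‖charPolyCircle V θ‖ : ℝ) : ℂ) ^ t *
      Complex.exp (Complex.I * s * (argCharPolyCircle V θ : ℂ))) μ ∧
    ∫ V, ((‖charPolyCircle V θ‖ : ℝ) : ℂ) ^ t *
      Complex.exp (Complex.I * s * (argCharPolyCircle V θ : ℂ)) ∂μ =
    ∏ k ∈ Finset.Icc 1 N,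
      Complex.Gamma k * Complex.Gamma (k + t) /
        (Complex.Gamma (k + (t + s) / 2) * Complex.Gamma (k + (t - s) / 2)) := by
  set g := unitaryScalar N (Circle.exp (-θ)) with hg
  have hne : ∀ᵐ V ∂μ, charPolyCircle V θ ≠ 0 := by
    simp_rw [charPolyCircle_eq_det]
    exact (eventually_mul_left_iff μ g).2 (ae_det_one_sub_ne_zero μ)
  have hae : (fun V => ((‖charPolyCircle V θ‖ : ℝ) : ℂ) ^ t *
      Complex.exp (Complex.I * s * (argCharPolyCircle V θ : ℂ))) =ᵐ[μ]
      fun V => expPair ((t + s) / 2) ((t - s) / 2) (logDetOneSub (g * V).1) := by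
    filter_upwards [hne] with V hV
    rw [argCharPolyCircle, logCharPolyCircle_eq_logDetOneSub]
    refine norm_cpow_mul_exp_arg_eq_expPair hV ?_
    rw [charPolyCircle_eq_det] at hV ⊢
    exact exp_logDetOneSub hV
  have ha : -1 / 2 < ((t + s) / 2).re := by
    rw [show (t + s) / 2 = ((1 / 2 : ℝ) : ℂ) * (t + s) by push_cast; ring, Complex.re_ofReal_mul]
    linarith
  have hb : -1 / 2 < ((t - s) / 2).re := by
    rw [show (t - s) / 2 = ((1 / 2 : ℝ) : ℂ) * (t - s) by push_cast; ring, Complex.re_ofReal_mul]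
    linarith
  obtain ⟨hi, hv⟩ := integral_expPair_logDetOneSub ha hb N μ
  refine ⟨hne, (hi.comp_mul_left g).congr hae.symm, ?_⟩
  rw [integral_congr_ae hae, integral_mul_left_eq_self (μ := μ)
    (fun V : Matrix.unitaryGroup (Fin N) ℂ =>
      expPair ((t + s) / 2) ((t - s) / 2) (logDetOneSub V.1)) g, hv]
  refine Finset.prod_congr rfl fun k _ => ?_
  rw [show (k : ℂ) + (t + s) / 2 + (t - s) / 2 = k + t by ring]
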